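/- An additively separable hedonic game (ASHG) consists of a directed graph $G=(V,E)$ and weights $w:V\times V\to\mathbb{Z}$ with $w(u,v)=0$ whenever $uv\notin E$. The utility of $v\in V$ for a coalition $S\subseteq V$ is $p_v(S)=\sum_{u\in S\setminus\{v\}}w(v,u)$. A partition $\pi$ of $V$ is Nash stable if for every $v\in V$, with $S$ the class of $\pi$ that contains $v$, we have $p_v(S)\ge 0$ and $p_v(S)\ge p_v(S')$ for all $S'\in\pi$. Maximum degree and pathwidth refer to the underlying undirected graph of $G$. **Theorem.** Assume the Exponential Time Hypothesis, in the (weak) form that 3-SAT on formulas with $n$ variables and $m$ clauses cannot be decided in time $2^{o(n)}(n+m)^{O(1)}$. Then there are constants $\Delta$ and $W$ such that no algorithm decides, for ASHGs on graphs with maximum degree at most $\Delta$ and with all weights of absolute value at most $W$, whether a Nash stable partition exists, in time $p^{o(p)}n^{O(1)}$, where $n$ is the number of vertices and $p$ is the pathwidth of the underlying graph. -/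

import Mathlib

open Filter Asymptotics

/-!
### Computation model

Algorithms are programs of the textbook WHILE language over binary trees (a structured pointer
machine / pure LISP machine). Finitely many variables occur in a program; every variable holds a
binary tree. An elementary command allocates at most one new cell or follows one pointer, and a
test only asks whether a tree is `nil`; each costs one step. With trees stored as pointers, the
model and multi-tape Turing machines simulate each other with polynomial overhead.
-/

/-- Values: binary trees. -/
inductive Data : Type
  | nil : Data
  | cons : Data → Data → Data

namespace Data

def head : Data → Data
  | nil => nil
  | cons a _ => a

def tail : Data → Data
  | nil => nil
  | cons _ b => b

/-- A list is coded as `cons x₁ (cons x₂ (… nil))`. -/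
def ofList : List Data → Data
  | [] => nil
  | x :: l => cons x (ofList l)

def ofBool : Bool → Data
  | false => nil
  | true => cons nil nil

/-- Unary code, used for the number of variables and for the indices of variables of a formula. -/
def ofNat (k : ℕ) : Data := ofList (List.replicate k nil)

/-- Integers: a sign bit and the absolute value in binary (least significant bit first). -/
def ofInt (z : ℤ) : Data := cons (ofBool (decide (z < 0))) (ofList (z.natAbs.bits.map ofBool))

end Data

/-- Programs. Variables are numbered by natural numbers. -/
inductive Prog : Type
  /-- `x := nil` -/
  | clear (x : ℕ) : Prog
  /-- `x := y` -/
  | copy (x y : ℕ) : Prog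
  /-- `x := cons y z` -/
  | cons (x y z : ℕ) : Prog
  /-- `x := head y` -/
  | head (x y : ℕ) : Prog
  /-- `x := tail y` -/
  | tail (x y : ℕ) : Prog
  /-- `p ; q` -/
  | seq (p q : Prog) : Prog
  /-- `if x ≠ nil then p else q` -/
  | cond (x : ℕ) (p q : Prog) : Prog
  /-- `while x ≠ nil do p` -/
  | loop (x : ℕ) (p : Prog) : Prog

namespace Prog

/-- The contents of all variables. -/
abbrev Store := ℕ → Data

/-- `Run p s t s'`: started in the store `s`, the program `p` halts after exactly `t` steps,
in the store `s'`. -/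
inductive Run : Prog → Store → ℕ → Store → Prop
  | clear (x : ℕ) (s : Store) : Run (clear x) s 1 (Function.update s x Data.nil)
  | copy (x y : ℕ) (s : Store) : Run (copy x y) s 1 (Function.update s x (s y))
  | cons (x y z : ℕ) (s : Store) :
      Run (cons x y z) s 1 (Function.update s x (Data.cons (s y) (s z)))
  | head (x y : ℕ) (s : Store) : Run (head x y) s 1 (Function.update s x (s y).head)
  | tail (x y : ℕ) (s : Store) : Run (tail x y) s 1 (Function.update s x (s y).tail)
  | seq {p q : Prog} {s s' s'' : Store} {t t' : ℕ} :
      Run p s t s' → Run q s' t' s'' → Run (seq p q) s (t + t') s''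
  | condTrue {x : ℕ} {p q : Prog} {s s' : Store} {t : ℕ} :
      s x ≠ Data.nil → Run p s t s' → Run (cond x p q) s (t + 1) s'
  | condFalse {x : ℕ} {p q : Prog} {s s' : Store} {t : ℕ} :
      s x = Data.nil → Run q s t s' → Run (cond x p q) s (t + 1) s'
  | loopDone {x : ℕ} {p : Prog} {s : Store} :
      s x = Data.nil → Run (loop x p) s 1 s
  | loopStep {x : ℕ} {p : Prog} {s s' s'' : Store} {t t' : ℕ} :
      s x ≠ Data.nil → Run p s t s' → Run (loop x p) s' t' s'' →
        Run (loop x p) s (t + t' + 1) s''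

/-- Programs are deterministic. -/
theorem Run.deterministic {p : Prog} {s s₁ s₂ : Prog.Store} {t₁ t₂ : ℕ}
    (h₁ : Prog.Run p s t₁ s₁) (h₂ : Prog.Run p s t₂ s₂) : t₁ = t₂ ∧ s₁ = s₂ := by
  induction h₁ generalizing t₂ s₂ with
  | seq _ _ ih ih' =>
    cases h₂ with
    | seq a b =>
      obtain ⟨rfl, rfl⟩ := ih a
      obtain ⟨rfl, rfl⟩ := ih' b
      exact ⟨rfl, rfl⟩
  | loopStep hx _ _ ih ih' =>
    cases h₂ with
    | loopDone h => exact absurd h hx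
    | loopStep _ a b =>
      obtain ⟨rfl, rfl⟩ := ih a
      obtain ⟨rfl, rfl⟩ := ih' b
      exact ⟨rfl, rfl⟩
  | condTrue hx _ ih => cases h₂ <;> grind
  | condFalse hx _ ih => cases h₂ <;> grind
  | loopDone hx => cases h₂ <;> grind
  | _ => cases h₂; exact ⟨rfl, rfl⟩

/-- The initial store: the input is in variable `0`, all other variables hold `nil`. -/
def initStore (d : Data) : Store := Function.update (fun _ => Data.nil) 0 d

/-- On input `d` the program `M` halts within `T` steps and answers the question `A` correctly;
the answer is "yes" if and only if variable `0` is not `nil` at the end. -/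
def AnswersWithin (M : Prog) (d : Data) (A : Prop) (T : ℝ) : Prop :=
  ∃ (t : ℕ) (s : Store), Run M (initStore d) t s ∧ (t : ℝ) ≤ T ∧ (s 0 ≠ Data.nil ↔ A)

end Prog

/-!
### 3-SAT and the Exponential Time Hypothesis
-/

/-- A literal over `n` variables: a variable and its sign (`true` for a positive literal). -/
abbrev Literal (n : ℕ) := Fin n × Bool

/-- A 3-CNF formula over `n` variables: a list of clauses, each with three literals, which may be
repeated (so the clauses are those with one, two or three distinct literals). -/
abbrev ThreeCNF (n : ℕ) := List (Literal n × Literal n × Literal n)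

namespace ThreeCNF

def Satisfiable {n : ℕ} (φ : ThreeCNF n) : Prop :=
  ∃ a : Fin n → Bool, ∀ c ∈ φ, a c.1.1 = c.1.2 ∨ a c.2.1.1 = c.2.1.2 ∨ a c.2.2.1 = c.2.2.2

def encodeLiteral {n : ℕ} (l : Literal n) : Data :=
  Data.cons (Data.ofNat (l.1 : ℕ)) (Data.ofBool l.2)

/-- The code of a formula: the number of variables and the list of clauses. -/
def encode {n : ℕ} (φ : ThreeCNF n) : Data :=
  Data.cons (Data.ofNat n)
    (Data.ofList (φ.map fun c =>
      Data.ofList [encodeLiteral c.1, encodeLiteral c.2.1, encodeLiteral c.2.2]))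

/-- `M` decides 3-SAT, using at most `T n m` steps for `n` variables and `m` clauses. -/
def DecidedInTime (M : Prog) (T : ℕ → ℕ → ℝ) : Prop :=
  ∀ (n : ℕ) (φ : ThreeCNF n), M.AnswersWithin φ.encode φ.Satisfiable (T n φ.length)

end ThreeCNF

/-- The Exponential Time Hypothesis, in the form: 3-SAT on formulas with `n` variables and `m`
clauses cannot be decided in time `2 ^ o(n) * (n + m) ^ O(1)`.
(A constant factor in the running time is absorbed by `f`.) -/
def ETH : Prop :=
  ¬ ∃ (M : Prog) (f : ℕ → ℝ) (k : ℕ), f =o[atTop] (fun n : ℕ => (n : ℝ)) ∧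
    ThreeCNF.DecidedInTime M fun n m => (2 : ℝ) ^ f n * ((n + m + 1 : ℕ) : ℝ) ^ k

/-- The other common form of the hypothesis: for some `c > 1` there is no `c ^ n` algorithm for
3-SAT, up to factors polynomial in the size of the formula. -/
def ETHConst : Prop :=
  ∃ c : ℝ, 1 < c ∧ ¬ ∃ (M : Prog) (C : ℝ) (k : ℕ),
    ThreeCNF.DecidedInTime M fun n m => C * c ^ n * ((n + m + 1 : ℕ) : ℝ) ^ k

/-- `ETH` is the weaker assumption of the two. -/
theorem ETHConst.toETH (h : ETHConst) : ETH := by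
  obtain ⟨c, hc, h⟩ := h
  rintro ⟨M, f, k, hf, hM⟩
  apply h
  have hlog : 0 < Real.logb 2 c := Real.logb_pos (by norm_num) hc
  have hev := hf.def hlog
  rw [eventually_atTop] at hev
  obtain ⟨N, hN⟩ := hev
  refine ⟨M, 1 + ∑ n ∈ Finset.range N, (2 : ℝ) ^ f n, k, ?_⟩
  intro n φ
  obtain ⟨t, s, hr, ht, hA⟩ := hM n φ
  refine ⟨t, s, hr, ht.trans ?_, hA⟩
  have hcn : (1 : ℝ) ≤ c ^ n := one_le_pow₀ hc.le
  have hpos : ∀ i ∈ Finset.range N, (0 : ℝ) ≤ (2 : ℝ) ^ f i := fun i _ => by positivity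
  have hsum : (0 : ℝ) ≤ ∑ i ∈ Finset.range N, (2 : ℝ) ^ f i := Finset.sum_nonneg hpos
  have key : (2 : ℝ) ^ f n ≤ (1 + ∑ n ∈ Finset.range N, (2 : ℝ) ^ f n) * c ^ n := by
    by_cases hn : N ≤ n
    · have h1 : f n ≤ Real.logb 2 c * n := by
        have := hN n hn
        rw [Real.norm_eq_abs, Real.norm_eq_abs, Nat.abs_cast] at this
        exact (le_abs_self _).trans this
      have h2 : (2 : ℝ) ^ f n ≤ c ^ n := by
        calc (2 : ℝ) ^ f n ≤ (2 : ℝ) ^ (Real.logb 2 c * n) :=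
              Real.rpow_le_rpow_of_exponent_le (by norm_num) h1
          _ = c ^ n := by
              rw [Real.rpow_mul (by norm_num), Real.rpow_logb (by norm_num) (by norm_num)
                (by linarith), Real.rpow_natCast]
      nlinarith
    · have h1 : (2 : ℝ) ^ f n ≤ ∑ i ∈ Finset.range N, (2 : ℝ) ^ f i :=
        Finset.single_le_sum hpos (Finset.mem_range.2 (not_le.1 hn))
      nlinarith
  exact mul_le_mul_of_nonneg_right key (by positivity)

/-!
### Pathwidth
-/

/-- A path decomposition of `G`: a sequence of bags that covers every vertex and every edge and
in which the bags containing a given vertex are consecutive. -/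
structure PathDecomposition {V : Type*} (G : SimpleGraph V) where
  length : ℕ
  bag : Fin length → Finset V
  vertex_mem : ∀ v, ∃ i, v ∈ bag i
  edge_mem : ∀ u v, G.Adj u v → ∃ i, u ∈ bag i ∧ v ∈ bag i
  consecutive : ∀ i j k, i ≤ j → j ≤ k → ∀ v, v ∈ bag i → v ∈ bag k → v ∈ bag j

/-- The pathwidth of a finite graph: the least `p` such that some path decomposition has all its
bags of size at most `p + 1`. -/
noncomputable def pathwidth {V : Type*} (G : SimpleGraph V) : ℕ :=
  sInf {p | ∃ P : PathDecomposition G, ∀ i, (P.bag i).card ≤ p + 1}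

/-!
### Additively separable hedonic games
-/

/-- An additively separable hedonic game on the vertices `0, …, n - 1`: a (simple) directed graph
and an integer weight function that vanishes outside its arcs. -/
structure ASHG (n : ℕ) where
  arcs : Finset (Fin n × Fin n)
  loopless : ∀ v, (v, v) ∉ arcs
  weight : Fin n → Fin n → ℤ
  weight_eq_zero : ∀ u v, (u, v) ∉ arcs → weight u v = 0

namespace ASHG

variable {n : ℕ}

/-- The utility of `v` for the coalition `S`. -/
def utility (G : ASHG n) (v : Fin n) (S : Finset (Fin n)) : ℤ := ∑ u ∈ S.erase v, G.weight v u

/-- No vertex can strictly increase its utility by moving to another coalition of the partition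
or by forming a singleton coalition. -/
def IsNashStable (G : ASHG n) (π : Finpartition (Finset.univ : Finset (Fin n))) : Prop :=
  ∀ v, ∀ S ∈ π.parts, v ∈ S →
    0 ≤ G.utility v S ∧ ∀ S' ∈ π.parts, G.utility v S' ≤ G.utility v S

def HasNashStablePartition (G : ASHG n) : Prop := ∃ π, G.IsNashStable π

/-- The underlying undirected graph. -/
def underlying (G : ASHG n) : SimpleGraph (Fin n) :=
  SimpleGraph.fromRel fun u v => (u, v) ∈ G.arcs

def MaxDegreeLE (G : ASHG n) (Δ : ℕ) : Prop := ∀ v, (G.underlying.neighborSet v).ncard ≤ Δ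

def AbsWeightLE (G : ASHG n) (W : ℕ) : Prop := ∀ u v, |G.weight u v| ≤ (W : ℤ)

/-- The code of a game: its adjacency matrix, row by row. The entry of a non-arc is `nil`, that of
an arc is `cons nil z` with `z` the code of its weight. -/
def encode (G : ASHG n) : Data :=
  Data.ofList (List.ofFn fun u : Fin n => Data.ofList (List.ofFn fun v : Fin n =>
    if (u, v) ∈ G.arcs then Data.cons Data.nil (Data.ofInt (G.weight u v)) else Data.nil))

end ASHG

/-- `M` decides, for the games with maximum degree at most `Δ` and absolute weights at most `W`,
whether there is a Nash stable partition, using at most `T n p` steps on a game with `n` vertices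
whose underlying graph has pathwidth `p`. (Nothing is required of `M` on other inputs.) -/
def NashStabilityDecidedInTime (Δ W : ℕ) (M : Prog) (T : ℕ → ℕ → ℝ) : Prop :=
  ∀ (n : ℕ) (G : ASHG n), G.MaxDegreeLE Δ → G.AbsWeightLE W →
    M.AnswersWithin G.encode G.HasNashStablePartition (T n (pathwidth G.underlying))

/-!
A 3-SAT formula with `n` variables is turned, in polynomial time, into a game of maximum degree at
most `12`, with weights of absolute value at most `3` and pathwidth `O(n / log n)`, that has a Nash
stable partition if and only if the formula is satisfiable. An algorithm for such games that runs in
time `p ^ o(p) * n ^ O(1)` would then decide 3-SAT in time `2 ^ o(n) * (n + m) ^ O(1)`.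

*Encoding.* The variables are divided into blocks of length `ℓ ≈ log n / 2`. The game consists of
time slices. In every slice there are `q = 2 ^ ℓ` anchors and one wire for every block. An anchor or
a wire has a single outgoing arc, of weight `1`, to its copy in the preceding slice, so in a stable
partition all its copies lie in one coalition. The assignment to a block is the number of the anchor
whose coalition contains the wire of the block. A slice has `O(q + n / ℓ) = O(n / log n)` vertices,
and arcs only join vertices of the same or of consecutive slices, so two consecutive slices form a
bag of a path decomposition (`pathwidth_wire_le`).

*Operations.* Each slice performs one operation with a gadget of constant size. An enforcement makes
sure that two vertices of the preceding slice lie in different coalitions; the gadget for this has a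
guard that follows it everywhere and that it dislikes (`IsStableColoring.ne_of_enforce`). It is used
to keep the anchors and a base wire apart. A test asks whether a block wire and an anchor lie in the
same coalition. A flag remembers whether some test succeeded since the last enforcement: it lies in
the coalition of the base wire as long as none did (`IsStableColoring.flag_tests`). For each clause
the tests of all pairs of a literal and an anchor satisfying it are made, and then the flag and the
base wire are enforced to differ. Thus stable partitions give satisfying assignments
(`exists_assignment_of_isStableColoring`), and conversely a satisfying assignment determines a
colouring of all vertices that is stable (`isStableColoring_circuitColor`,
`exists_isStableColoring_of_assignment`). The operations are stored with the last one first, so that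
a time slice is a final segment of the list of operations.

*Computability.* The reduction is composed from a small library of functions for which WHILE
programs of polynomial running time exist, with bounded iteration over lists as its main closure
property (`PolyTime`, `PolyTime.foldl`).
-/

/-! ### Total correctness with step counts -/

namespace Prog

/-- Started in `s`, the program `p` halts within `T` steps in a store that satisfies `Q`. -/
def Reaches (p : Prog) (s : Store) (T : ℕ) (Q : Store → Prop) : Prop :=
  ∃ t s', Run p s t s' ∧ t ≤ T ∧ Q s'

namespace Reaches

variable {p q : Prog} {s : Store} {T T' : ℕ} {Q R : Store → Prop} {x y z : ℕ}

theorem mono (h : Reaches p s T Q) (hT : T ≤ T') (hQ : ∀ s', Q s' → R s') :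
    Reaches p s T' R := by
  obtain ⟨t, s', hr, ht, hq⟩ := h
  exact ⟨t, s', hr, ht.trans hT, hQ _ hq⟩

theorem seq (h : Reaches p s T fun s' => Reaches q s' T' Q) : Reaches (seq p q) s (T + T') Q := by
  obtain ⟨t, s', hr, ht, t', s'', hr', ht', hq⟩ := h
  exact ⟨_, _, hr.seq hr', add_le_add ht ht', hq⟩

theorem clear (h : Q (Function.update s x Data.nil)) : Reaches (clear x) s 1 Q :=
  ⟨_, _, Run.clear x s, le_rfl, h⟩

theorem copy (h : Q (Function.update s x (s y))) : Reaches (copy x y) s 1 Q :=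
  ⟨_, _, Run.copy x y s, le_rfl, h⟩

theorem cons (h : Q (Function.update s x (Data.cons (s y) (s z)))) : Reaches (cons x y z) s 1 Q :=
  ⟨_, _, Run.cons x y z s, le_rfl, h⟩

theorem head (h : Q (Function.update s x (s y).head)) : Reaches (head x y) s 1 Q :=
  ⟨_, _, Run.head x y s, le_rfl, h⟩

theorem tail (h : Q (Function.update s x (s y).tail)) : Reaches (tail x y) s 1 Q :=
  ⟨_, _, Run.tail x y s, le_rfl, h⟩

theorem condTrue (hx : s x ≠ Data.nil) (h : Reaches p s T Q) :
    Reaches (cond x p q) s (T + 1) Q := by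
  obtain ⟨t, s', hr, ht, hq⟩ := h
  exact ⟨_, _, hr.condTrue hx, by omega, hq⟩

theorem condFalse (hx : s x = Data.nil) (h : Reaches q s T Q) :
    Reaches (cond x p q) s (T + 1) Q := by
  obtain ⟨t, s', hr, ht, hq⟩ := h
  exact ⟨_, _, hr.condFalse hx, by omega, hq⟩

theorem loopDone (hx : s x = Data.nil) (h : Q s) : Reaches (loop x p) s 1 Q :=
  ⟨_, _, Run.loopDone hx, le_rfl, h⟩

theorem loopStep (hx : s x ≠ Data.nil) (h : Reaches p s T fun s' => Reaches (loop x p) s' T' Q) :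
    Reaches (loop x p) s (T + T' + 1) Q := by
  obtain ⟨t, s', hr, ht, t', s'', hr', ht', hq⟩ := h
  exact ⟨_, _, hr.loopStep hx hr', by omega, hq⟩

end Reaches

/-- A program mentions finitely many variables. -/
theorem exists_unchanged (p : Prog) :
    ∃ K, ∀ s t s', Run p s t s' → ∀ i, K ≤ i → s' i = s i := by
  induction p with
  | clear x | copy x | cons x | head x | tail x =>
    refine ⟨x + 1, fun s t s' h i hi => ?_⟩
    cases h
    exact Function.update_of_ne (by omega) _ _
  | seq p q ihp ihq =>
    obtain ⟨K, hK⟩ := ihp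
    obtain ⟨K', hK'⟩ := ihq
    refine ⟨max K K', fun s t s' h i hi => ?_⟩
    cases h with
    | seq h h' =>
      rw [hK' _ _ _ h' i (le_of_max_le_right hi), hK _ _ _ h i (le_of_max_le_left hi)]
  | cond x p q ihp ihq =>
    obtain ⟨K, hK⟩ := ihp
    obtain ⟨K', hK'⟩ := ihq
    refine ⟨max K K', fun s t s' h i hi => ?_⟩
    cases h with
    | condTrue _ h => exact hK _ _ _ h i (le_of_max_le_left hi)
    | condFalse _ h => exact hK' _ _ _ h i (le_of_max_le_right hi)
  | loop x p ih =>
    obtain ⟨K, hK⟩ := ih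
    refine ⟨K, fun s t s' h i hi => ?_⟩
    generalize hl : loop x p = l at h
    induction h with
    | loopDone => rfl
    | loopStep _ h _ _ ih =>
      cases hl
      rw [ih rfl, hK _ _ _ h i hi]
    | _ => cases hl

/-- Set the variables `1, …, K` to `nil`. -/
def clearUpTo : ℕ → Prog
  | 0 => clear 1
  | K + 1 => seq (clear (K + 1)) (clearUpTo K)

theorem reaches_clearUpTo (K : ℕ) (s : Store) (hs : ∀ i, K < i → s i = Data.nil) :
    Reaches (clearUpTo K) s (K + 1) fun s' => s' = initStore (s 0) := by
  induction K generalizing s with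
  | zero =>
    refine Reaches.clear (funext fun i => ?_)
    rcases i with _ | _ | i <;> simp [initStore]
    exact hs _ (by omega)
  | succ K ih =>
    refine Reaches.mono (Reaches.seq (Reaches.clear ((ih _ ?_)))) (by omega) (fun s' h => ?_)
    · intro i hi
      by_cases h : i = K + 1
      · simp [h]
      · rw [Function.update_of_ne h]
        exact hs i (by omega)
    · simpa [Function.update_apply] using h

end Prog

/-! ### Polynomial-time functions -/

namespace Data

/-- The number of inner nodes of a tree. -/
def size : Data → ℕ
  | nil => 0
  | cons a b => size a + size b + 1

end Data

/-- A type whose elements are coded by binary trees. -/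
class DataCode (α : Type*) where
  /-- The tree that codes an element. -/
  code : α → Data

open DataCode (code)

namespace DataCode

instance : DataCode Data := ⟨id⟩
instance : DataCode Bool := ⟨Data.ofBool⟩
instance : DataCode ℕ := ⟨Data.ofNat⟩
instance : DataCode ℤ := ⟨Data.ofInt⟩

instance {α β : Type*} [DataCode α] [DataCode β] : DataCode (α × β) :=
  ⟨fun a => Data.cons (code a.1) (code a.2)⟩

instance {α : Type*} [DataCode α] : DataCode (List α) := ⟨fun l => Data.ofList (l.map code)⟩

instance {α : Type*} [DataCode α] : DataCode (Option α) :=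
  ⟨fun o => o.elim Data.nil fun a => Data.cons Data.nil (code a)⟩

variable {α β : Type*} [DataCode α] [DataCode β]

theorem code_prod (a : α) (b : β) : code (a, b) = Data.cons (code a) (code b) := rfl

theorem code_nil : code ([] : List α) = Data.nil := rfl

theorem code_cons (a : α) (l : List α) : code (a :: l) = Data.cons (code a) (code l) := rfl

theorem code_succ (n : ℕ) : code (n + 1) = Data.cons Data.nil (code n) := rfl

theorem code_some (a : α) : code (some a) = Data.cons Data.nil (code a) := rfl

/-- The size of the code of an element. -/
def codeSize (a : α) : ℕ := (code a).size

@[simp] theorem codeSize_prod (a : α) (b : β) : codeSize (a, b) = codeSize a + codeSize b + 1 := rfl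

@[simp] theorem codeSize_nil : codeSize ([] : List α) = 0 := rfl

@[simp] theorem codeSize_cons (a : α) (l : List α) :
    codeSize (a :: l) = codeSize a + codeSize l + 1 := rfl

@[simp] theorem codeSize_nat (n : ℕ) : codeSize n = n := by
  induction n with
  | zero => rfl
  | succ n ih => rw [codeSize, code_succ, Data.size, ← codeSize, ih]; simp [Data.size]

theorem codeSize_bool (b : Bool) : codeSize b ≤ 1 := by cases b <;> decide

theorem codeSize_append (l l' : List α) : codeSize (l ++ l') = codeSize l + codeSize l' := by
  induction l with
  | nil => simp
  | cons a l ih => simp [ih]; omega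

theorem length_le_codeSize (l : List α) : l.length ≤ codeSize l := by
  induction l with
  | nil => simp
  | cons a l ih => simp; omega

theorem codeSize_le_of_mem {l : List α} {a : α} (h : a ∈ l) : codeSize a ≤ codeSize l := by
  induction l with
  | nil => simp at h
  | cons b l ih =>
    rcases List.mem_cons.1 h with rfl | h
    · simp; omega
    · have := ih h
      simp; omega

theorem codeSize_drop_le (l : List α) (k : ℕ) : codeSize (l.drop k) ≤ codeSize l := by
  have := codeSize_append (l.take k) (l.drop k)
  rw [List.take_append_drop] at this
  omega

end DataCode

open DataCode

section PolyBounded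

variable {α β : Type*} [DataCode α] [DataCode β]

/-- `T a` is at most polynomial in the size of the code of `a`. The base `size + 2` makes a single
exponent suffice. -/
def PolyBounded (T : α → ℕ) : Prop := ∃ k : ℕ, ∀ a, T a ≤ (codeSize a + 2) ^ k

namespace PolyBounded

variable {T T' : α → ℕ}

theorem mono (h : PolyBounded T) (hle : ∀ a, T' a ≤ T a) : PolyBounded T' :=
  h.imp fun _ hk a => (hle a).trans (hk a)

theorem const (c : ℕ) : PolyBounded fun _ : α => c :=
  ⟨c, fun a => (Nat.lt_two_pow_self).le.trans (Nat.pow_le_pow_left (by omega) c)⟩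

theorem codeSize : PolyBounded fun a : α => codeSize a := ⟨1, fun a => by simp⟩

theorem add (h : PolyBounded T) (h' : PolyBounded T') : PolyBounded fun a => T a + T' a := by
  obtain ⟨k, hk⟩ := h
  obtain ⟨k', hk'⟩ := h'
  refine ⟨k + k' + 1, fun a => ?_⟩
  have h1 : T a ≤ (DataCode.codeSize a + 2) ^ (k + k') :=
    (hk a).trans (Nat.pow_le_pow_right (by omega) (by omega))
  have h2 : T' a ≤ (DataCode.codeSize a + 2) ^ (k + k') :=
    (hk' a).trans (Nat.pow_le_pow_right (by omega) (by omega))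
  rw [pow_succ]
  nlinarith [Nat.zero_le (DataCode.codeSize a), Nat.zero_le ((DataCode.codeSize a + 2) ^ (k + k'))]

theorem mul (h : PolyBounded T) (h' : PolyBounded T') : PolyBounded fun a => T a * T' a := by
  obtain ⟨k, hk⟩ := h
  obtain ⟨k', hk'⟩ := h'
  exact ⟨k + k', fun a => by rw [pow_add]; exact Nat.mul_le_mul (hk a) (hk' a)⟩

theorem pow (h : PolyBounded T) (j : ℕ) : PolyBounded fun a => T a ^ j := by
  obtain ⟨k, hk⟩ := h
  exact ⟨k * j, fun a => by rw [pow_mul]; exact Nat.pow_le_pow_left (hk a) j⟩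

theorem comp {T : β → ℕ} (h : PolyBounded T) {f : α → β}
    (hf : PolyBounded fun a => DataCode.codeSize (f a)) : PolyBounded fun a => T (f a) := by
  obtain ⟨k, hk⟩ := h
  exact ((hf.add (const 2)).pow k).mono fun a => hk _

end PolyBounded

end PolyBounded

section PolyTime

variable {α β γ δ : Type*} [DataCode α] [DataCode β] [DataCode γ] [DataCode δ]

/-- The program `p` computes `f` in time `T`: it replaces the code of `a` in variable `b` by the
code of `f a`. The variables below `b` are kept, those above `b` may hold anything before and
after. -/
def Prog.Computes (p : Prog) (b : ℕ) (f : α → β) (T : α → ℕ) : Prop :=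
  ∀ (s : Prog.Store) (a : α), s b = code a →
    p.Reaches s (T a) fun s' => s' b = code (f a) ∧ ∀ i < b, s' i = s i

/-- Functions computed by programs in polynomial time, with results of polynomial size (as trees,
not as pointer structures). The base variable `b` is arbitrary, so that such a program can be used
as a subroutine while the variables below `b` hold other values. -/
@[fun_prop]
def PolyTime (f : α → β) : Prop :=
  PolyBounded (fun a => codeSize (f a)) ∧
    ∃ T : α → ℕ, PolyBounded T ∧ ∀ b, ∃ p : Prog, p.Computes b f T

namespace PolyTime

@[fun_prop]
theorem id : PolyTime fun a : α => a :=
  ⟨.codeSize, fun _ => 1, .const 1, fun b => ⟨.copy b b, fun s a h =>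
    .copy ⟨by simpa using h, fun i hi => Function.update_of_ne hi.ne _ _⟩⟩⟩

@[fun_prop]
theorem comp {g : β → γ} {f : α → β} (hg : PolyTime g) (hf : PolyTime f) :
    PolyTime fun a => g (f a) := by
  obtain ⟨hgs, Tg, hTg, hg⟩ := hg
  obtain ⟨hfs, Tf, hTf, hf⟩ := hf
  refine ⟨hgs.comp hfs, fun a => Tf a + Tg (f a), hTf.add (hTg.comp hfs), fun b => ?_⟩
  obtain ⟨p, hp⟩ := hf b
  obtain ⟨q, hq⟩ := hg b
  refine ⟨.seq p q, fun s a h => .seq ((hp s a h).mono le_rfl fun s' h' => ?_)⟩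
  exact (hq s' _ h'.1).mono le_rfl fun s'' h'' =>
    ⟨h''.1, fun i hi => (h''.2 i hi).trans (h'.2 i hi)⟩

@[fun_prop]
theorem const (c : β) : PolyTime fun _ : α => c := by
  suffices h : ∀ d : Data, ∃ k : ℕ, ∀ b, ∃ p : Prog, ∀ s : Prog.Store,
      p.Reaches s k fun s' => s' b = d ∧ ∀ i < b, s' i = s i by
    obtain ⟨k, hk⟩ := h (code c)
    refine ⟨.const _, fun _ => k, .const k, fun b => ?_⟩
    obtain ⟨p, hp⟩ := hk b
    exact ⟨p, fun s a _ => hp s⟩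
  intro d
  induction d with
  | nil =>
    exact ⟨1, fun b => ⟨.clear b, fun s => .clear
      ⟨by simp, fun i hi => Function.update_of_ne hi.ne _ _⟩⟩⟩
  | cons d e ihd ihe =>
    obtain ⟨k, hk⟩ := ihd
    obtain ⟨k', hk'⟩ := ihe
    refine ⟨k + (k' + 1), fun b => ?_⟩
    obtain ⟨p, hp⟩ := hk b
    obtain ⟨q, hq⟩ := hk' (b + 1)
    refine ⟨.seq p (.seq q (.cons b b (b + 1))), fun s => .seq ((hp s).mono le_rfl fun s₁ h₁ =>
      .seq ((hq s₁).mono le_rfl fun s₂ h₂ => .cons ⟨?_, fun i hi => ?_⟩))⟩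
    · simp [h₂.1, h₂.2 b (by omega), h₁.1]
    · rw [Function.update_of_ne hi.ne, h₂.2 i (by omega), h₁.2 i hi]

@[fun_prop]
theorem prodMk {f : α → β} {g : α → γ} (hf : PolyTime f) (hg : PolyTime g) :
    PolyTime fun a => (f a, g a) := by
  obtain ⟨hfs, Tf, hTf, hf⟩ := hf
  obtain ⟨hgs, Tg, hTg, hg⟩ := hg
  refine ⟨(hfs.add hgs).add (.const 1), fun a => 1 + (Tf a + (1 + (Tg a + 1))),
    (PolyBounded.const 1).add (hTf.add ((PolyBounded.const 1).add (hTg.add (.const 1)))),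
    fun b => ?_⟩
  obtain ⟨p, hp⟩ := hf (b + 1)
  obtain ⟨q, hq⟩ := hg (b + 2)
  refine ⟨.seq (.copy (b + 1) b) (.seq p (.seq (.copy (b + 2) b) (.seq q
    (.cons b (b + 1) (b + 2))))), fun s a h => .seq (.copy (.seq ?_))⟩
  refine (hp _ a (by simpa using h)).mono le_rfl fun s₁ h₁ => .seq (.copy (.seq ?_))
  refine (hq _ a (by simp [h₁.2 b (by omega), h])).mono le_rfl fun s₂ h₂ => .cons ⟨?_, ?_⟩
  · simp [h₂.1, h₂.2 (b + 1) (by omega), h₁.1, code_prod]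
  · intro i hi
    rw [Function.update_of_ne hi.ne, h₂.2 i (by omega), Function.update_of_ne (by omega),
      h₁.2 i (by omega), Function.update_of_ne (by omega)]

@[fun_prop]
theorem fst {f : α → β × γ} (hf : PolyTime f) : PolyTime fun a => (f a).1 := by
  refine comp (g := Prod.fst) ⟨PolyBounded.codeSize.mono fun a => ?_, fun _ => 1, .const 1,
    fun b => ⟨.head b b, fun s a h => .head ⟨?_, fun i hi => Function.update_of_ne hi.ne _ _⟩⟩⟩ hf
  · obtain ⟨x, y⟩ := a
    simp; omega
  · simp [h, code, Data.head]

@[fun_prop]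
theorem snd {f : α → β × γ} (hf : PolyTime f) : PolyTime fun a => (f a).2 := by
  refine comp (g := Prod.snd) ⟨PolyBounded.codeSize.mono fun a => ?_, fun _ => 1, .const 1,
    fun b => ⟨.tail b b, fun s a h => .tail ⟨?_, fun i hi => Function.update_of_ne hi.ne _ _⟩⟩⟩ hf
  · obtain ⟨x, y⟩ := a
    simp; omega
  · simp [h, code, Data.tail]

/-- Two functions with the same codes: a change of the type is free. -/
theorem congr_code {f : α → β} (hf : PolyTime f) {f' : α → γ} (h : ∀ a, code (f' a) = code (f a)) :
    PolyTime f' := by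
  obtain ⟨hfs, Tf, hTf, hf⟩ := hf
  refine ⟨hfs.mono fun a => (congrArg Data.size (h a)).le, Tf, hTf, fun b => ?_⟩
  obtain ⟨p, hp⟩ := hf b
  exact ⟨p, fun s a hs => by rw [h]; exact hp s a hs⟩

@[fun_prop]
theorem cons {f : α → β} {g : α → List β} (hf : PolyTime f) (hg : PolyTime g) :
    PolyTime fun a => f a :: g a :=
  (hf.prodMk hg).congr_code fun _ => rfl

@[fun_prop]
theorem some {f : α → β} (hf : PolyTime f) : PolyTime fun a => some (f a) :=
  ((const Data.nil).prodMk hf).congr_code fun _ => rfl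

@[fun_prop]
theorem succ {f : α → ℕ} (hf : PolyTime f) : PolyTime fun a => f a + 1 :=
  ((const Data.nil).prodMk hf).congr_code fun _ => rfl

@[fun_prop]
theorem tail {f : α → List β} (hf : PolyTime f) : PolyTime fun a => (f a).tail := by
  refine comp (g := List.tail) ⟨PolyBounded.codeSize.mono fun a => ?_, fun _ => 1, .const 1,
    fun b => ⟨.tail b b, fun s a h => .tail ⟨?_, fun i hi => Function.update_of_ne hi.ne _ _⟩⟩⟩ hf
  · cases a <;> simp; omega
  · cases a <;> simp [h, code, Data.tail, Data.ofList]

@[fun_prop]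
theorem isEmpty {f : α → List β} (hf : PolyTime f) : PolyTime fun a => (f a).isEmpty := by
  refine comp (g := List.isEmpty) ⟨(PolyBounded.const 1).mono fun a => codeSize_bool _, fun _ => 3,
    .const 3, fun b => ⟨.cond b (.clear b) (.seq (.clear b) (.cons b b b)), fun s a h => ?_⟩⟩ hf
  cases a with
  | nil =>
    refine .condFalse (by rw [h]; rfl) (.seq (.clear (.cons ⟨?_, fun i hi => ?_⟩)))
    · simp [code, Data.ofBool]
    · rw [Function.update_of_ne hi.ne, Function.update_of_ne hi.ne]
  | cons x l =>
    refine (Prog.Reaches.condTrue (T := 1) (by rw [h]; simp [code_cons])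
      (.clear ⟨?_, fun i hi => ?_⟩)).mono (by simp) fun _ => _root_.id
    · simp [code, Data.ofBool]
    · rw [Function.update_of_ne hi.ne]

@[fun_prop]
theorem cond {c : α → Bool} {f g : α → β} (hc : PolyTime c) (hf : PolyTime f) (hg : PolyTime g) :
    PolyTime fun a => bif c a then f a else g a := by
  obtain ⟨-, Tc, hTc, hc⟩ := hc
  obtain ⟨hfs, Tf, hTf, hf⟩ := hf
  obtain ⟨hgs, Tg, hTg, hg⟩ := hg
  refine ⟨(hfs.add hgs).mono fun a => by cases h : c a <;> simp [h],
    fun a => 1 + (Tc a + (Tf a + Tg a + 1)),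
    (PolyBounded.const 1).add (hTc.add ((hTf.add hTg).add (.const 1))), fun b => ?_⟩
  obtain ⟨r, hr⟩ := hc (b + 1)
  obtain ⟨p, hp⟩ := hf b
  obtain ⟨q, hq⟩ := hg b
  refine ⟨.seq (.copy (b + 1) b) (.seq r (.cond (b + 1) p q)), fun s a h => .seq (.copy (.seq ?_))⟩
  refine (hr _ a (by simpa using h)).mono le_rfl fun s₁ h₁ => ?_
  have hb : s₁ b = code a := by rw [h₁.2 b (by omega)]; simpa using h
  have hlt : ∀ i < b, s₁ i = s i := fun i hi => by
    rw [h₁.2 i (by omega), Function.update_of_ne (by omega)]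
  cases hca : c a with
  | true =>
    refine (Prog.Reaches.condTrue (by rw [h₁.1, hca]; simp [code, Data.ofBool]) (hp s₁ a hb)).mono
      (by omega) fun s₂ h₂ => ⟨by simp [hca, h₂.1], fun i hi => (h₂.2 i hi).trans (hlt i hi)⟩
  | false =>
    refine (Prog.Reaches.condFalse (by rw [h₁.1, hca]; simp [code, Data.ofBool]) (hq s₁ a hb)).mono
      (by omega) fun s₂ h₂ => ⟨by simp [hca, h₂.1], fun i hi => (h₂.2 i hi).trans (hlt i hi)⟩

/-- Iteration over a list. The size of the accumulator must grow at most by a polynomial amount per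
step, where the polynomial does not depend on the accumulator. -/
theorem foldl {l : α → List γ} {init : α → β} {step : α × β × γ → β} (hl : PolyTime l)
    (hinit : PolyTime init) (hstep : PolyTime step) {B : α → ℕ} (hB : PolyBounded B)
    (hsB : ∀ a acc, ∀ x ∈ l a, codeSize (step (a, acc, x)) ≤ codeSize acc + B a) :
    PolyTime fun a => (l a).foldl (fun acc x => step (a, acc, x)) (init a) := by
  obtain ⟨hls, Tl, hTl, hl⟩ := hl
  obtain ⟨his, Ti, hTi, hinit⟩ := hinit
  obtain ⟨-, Ts, ⟨k, hTs⟩, hstep⟩ := hstep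
  have hlen : PolyBounded fun a => (l a).length := hls.mono fun a => length_le_codeSize _
  -- a bound for the accumulators
  set A : α → ℕ := fun a => codeSize (init a) + (l a).length * B a with hA
  have hAb : PolyBounded A := his.add (hlen.mul hB)
  -- a bound for the time of a step
  set U : α → ℕ := fun a => (codeSize a + (A a + codeSize (l a) + 1) + 1 + 2) ^ k with hU
  have hUb : PolyBounded U :=
    (((PolyBounded.codeSize.add ((hAb.add hls).add (.const 1))).add (.const 1)).add (.const 2)).pow k
  have hsize : ∀ a, ∀ l' : List γ, ∀ acc j, (∀ x ∈ l', x ∈ l a) → l'.length + j = (l a).length →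
      codeSize acc ≤ codeSize (init a) + j * B a →
      codeSize (l'.foldl (fun acc x => step (a, acc, x)) acc) ≤ A a := by
    intro a l'
    induction l' with
    | nil => intro acc j _ hj hacc; simpa [hA, ← hj] using hacc
    | cons x l' ih =>
      intro acc j hmem hj hacc
      refine ih _ (j + 1) (fun y hy => hmem y (List.mem_cons_of_mem _ hy))
        (by simp at hj; omega) ((hsB a acc x (hmem x List.mem_cons_self)).trans ?_)
      rw [add_mul]; omega
  refine ⟨hAb.mono fun a => hsize a (l a) _ 0 (fun _ => _root_.id) (by simp) (by simp),
    fun a => 1 + (Tl a + (1 + (Ti a + ((l a).length * (6 + U a) + 1 + 1)))),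
    (PolyBounded.const 1).add (hTl.add ((PolyBounded.const 1).add (hTi.add
      (((hlen.mul ((PolyBounded.const 6).add hUb)).add (.const 1)).add (.const 1))))), fun b => ?_⟩
  obtain ⟨pl, hpl⟩ := hl (b + 1)
  obtain ⟨pi, hpi⟩ := hinit (b + 2)
  obtain ⟨ps, hps⟩ := hstep (b + 3)
  set body : Prog := .seq (.head (b + 3) (b + 1)) (.seq (.cons (b + 3) (b + 2) (b + 3))
    (.seq (.cons (b + 3) b (b + 3)) (.seq ps (.seq (.copy (b + 2) (b + 3))
      (.tail (b + 1) (b + 1)))))) with hbody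
  have hloop : ∀ a, ∀ l' : List γ, ∀ acc j, (∀ x ∈ l', x ∈ l a) → l'.length + j = (l a).length →
      codeSize acc ≤ codeSize (init a) + j * B a → ∀ s : Prog.Store, s b = code a →
      s (b + 1) = code l' → s (b + 2) = code acc →
      (Prog.loop (b + 1) body).Reaches s (l'.length * (6 + U a) + 1) fun s' =>
        s' (b + 2) = code (l'.foldl (fun acc x => step (a, acc, x)) acc) ∧ ∀ i < b, s' i = s i := by
    intro a l'
    induction l' with
    | nil =>
      exact fun acc j _ _ _ s _ h1 h2 => (Prog.Reaches.loopDone h1 ⟨h2, fun _ _ => rfl⟩).mono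
        (by simp) fun _ => _root_.id
    | cons x l' ih =>
      intro acc j hmem hj hacc s h0 h1 h2
      have hx : x ∈ l a := hmem x List.mem_cons_self
      have haccA : codeSize acc ≤ A a := hacc.trans (by
        have : j ≤ (l a).length := by omega
        simp only [hA]; gcongr)
      have hTU : Ts (a, acc, x) ≤ U a := (hTs _).trans (by
        have := codeSize_le_of_mem hx
        simp only [hU]; gcongr; simp; omega)
      refine Prog.Reaches.mono (Prog.Reaches.loopStep (T := 1 + (1 + (1 + (U a + (1 + 1)))))
        (T' := l'.length * (6 + U a) + 1) (by simp [h1, code_cons]) ?_)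
        (by simp [add_mul]; omega) fun _ => _root_.id
      refine .seq (.head (.seq (.cons (.seq (.cons (.seq ?_))))))
      refine (hps _ (a, acc, x) (by simp [h0, h1, h2, code_prod, code_cons, Data.head])).mono hTU
        fun s₁ h₁ => .seq (.copy (.tail ?_))
      have hk : ∀ i < b + 3, s₁ i = s i := fun i hi => by
        rw [h₁.2 i hi, Function.update_of_ne (by omega), Function.update_of_ne (by omega),
          Function.update_of_ne (by omega)]
      refine (ih (step (a, acc, x)) (j + 1) (fun y hy => hmem y (List.mem_cons_of_mem _ hy))
        (by simp at hj; omega) ((hsB a acc x hx).trans (by rw [add_mul]; omega)) _ ?_ ?_ ?_).mono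
        le_rfl fun s₂ h₂ => ⟨h₂.1, fun i hi => ?_⟩
      · simp [hk b (by omega), h0]
      · simp [hk (b + 1) (by omega), h1, code_cons, Data.tail]
      · simp [h₁.1]
      · rw [h₂.2 i hi, Function.update_of_ne (by omega), Function.update_of_ne (by omega),
          hk i (by omega)]
  refine ⟨.seq (.copy (b + 1) b) (.seq pl (.seq (.copy (b + 2) b) (.seq pi (.seq
    (.loop (b + 1) body) (.copy b (b + 2)))))), fun s a h => .seq (.copy (.seq ?_))⟩
  refine (hpl _ a (by simpa using h)).mono le_rfl fun s₁ h₁ => .seq (.copy (.seq ?_))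
  refine (hpi _ a (by simp [h₁.2 b (by omega), h])).mono le_rfl fun s₂ h₂ => .seq ?_
  have hk : ∀ i ≤ b, s₂ i = s i := fun i hi => by
    rw [h₂.2 i (by omega), Function.update_of_ne (by omega), h₁.2 i (by omega),
      Function.update_of_ne (by omega)]
  refine (hloop a (l a) (init a) 0 (fun _ => _root_.id) (by simp) (by simp) s₂
    (by rw [hk b le_rfl, h]) (by rw [h₂.2 (b + 1) (by omega)]; simpa using h₁.1) h₂.1).mono le_rfl
    fun s₃ h₃ => .copy ⟨by simp [h₃.1], fun i hi => ?_⟩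
  rw [Function.update_of_ne hi.ne, h₃.2 i hi, hk i hi.le]

end PolyTime

end PolyTime

/-! ### A library of polynomial-time functions -/

namespace PolyTime

variable {α β γ δ : Type*} [DataCode α] [DataCode β] [DataCode γ] [DataCode δ]

theorem congr {f f' : α → β} (hf : PolyTime f) (h : ∀ a, f a = f' a) : PolyTime f' :=
  funext h ▸ hf

@[fun_prop]
theorem and {f g : α → Bool} (hf : PolyTime f) (hg : PolyTime g) :
    PolyTime fun a => f a && g a := by
  have := hf.cond hg (const false)
  simpa only [Bool.cond_false_right] using this

@[fun_prop]
theorem not {f : α → Bool} (hf : PolyTime f) : PolyTime fun a => !f a := by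
  have := hf.cond (const false) (const true)
  simpa only [Bool.cond_false_left, Bool.and_true] using this

@[fun_prop]
theorem ite {c : α → Prop} [DecidablePred c] {f g : α → β} (hc : PolyTime fun a => decide (c a))
    (hf : PolyTime f) (hg : PolyTime g) : PolyTime fun a => if c a then f a else g a := by
  have := hc.cond hf hg
  simpa only [Bool.cond_decide] using this

@[fun_prop]
theorem boolEq {f g : α → Bool} (hf : PolyTime f) (hg : PolyTime g) :
    PolyTime fun a => decide (f a = g a) := by
  have := hf.cond hg hg.not
  refine this.congr fun a => ?_
  cases f a <;> cases g a <;> rfl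

@[fun_prop]
theorem reverse {f : α → List β} (hf : PolyTime f) : PolyTime fun a => (f a).reverse := by
  have := foldl (step := fun p : α × List β × β => p.2.2 :: p.2.1) hf (const []) (by fun_prop)
    (hf.1.add (.const 1)) (fun a acc x hx => by
      have := codeSize_le_of_mem hx
      simp; omega)
  simpa only [List.foldl_flip_cons_eq_append', List.append_nil] using this

/-- Iteration over a list from its end; see `PolyTime.foldl`. -/
theorem foldr {l : α → List γ} {init : α → β} {step : α → γ → β → β} (hl : PolyTime l)
    (hinit : PolyTime init) (hstep : PolyTime fun p : α × β × γ => step p.1 p.2.2 p.2.1)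
    {B : α → ℕ} (hB : PolyBounded B)
    (hsB : ∀ a, ∀ x ∈ l a, ∀ acc, codeSize (step a x acc) ≤ codeSize acc + B a) :
    PolyTime fun a => (l a).foldr (step a) (init a) := by
  have := foldl hl.reverse hinit hstep hB
    (fun a acc x hx => hsB a x (List.mem_reverse.1 hx) acc)
  simpa only [List.foldl_reverse] using this

@[fun_prop]
theorem append {f g : α → List β} (hf : PolyTime f) (hg : PolyTime g) :
    PolyTime fun a => f a ++ g a := by
  have := foldr (step := fun _ x acc => x :: acc) hf hg (by fun_prop)
    (hf.1.add (.const 1)) (fun a x hx acc => by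
      have := codeSize_le_of_mem hx
      simp; omega)
  simpa only [List.foldr_cons_eq_append'] using this

theorem flatMap {l : α → List γ} {f : α → γ → List β} (hl : PolyTime l)
    (hf : PolyTime fun p : α × γ => f p.1 p.2) : PolyTime fun a => (l a).flatMap (f a) := by
  obtain ⟨k, hk⟩ := hf.1
  have := foldr (step := fun a x acc => f a x ++ acc) hl (const [])
    (.append (hf.comp (f := fun p : α × List β × γ => (p.1, p.2.2)) (by fun_prop)) (by fun_prop))
    (B := fun a => (codeSize a + codeSize (l a) + 1 + 2) ^ k)
    ((((PolyBounded.codeSize.add hl.1).add (.const 1)).add (.const 2)).pow k)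
    (fun a x hx acc => by
      rw [codeSize_append, add_comm]
      refine Nat.add_le_add_left ((hk (a, x)).trans ?_) _
      have := codeSize_le_of_mem hx
      gcongr; simp; omega)
  refine this.congr fun a => ?_
  induction l a with
  | nil => rfl
  | cons x l ih => simp [ih]

theorem map {l : α → List γ} {f : α → γ → β} (hl : PolyTime l)
    (hf : PolyTime fun p : α × γ => f p.1 p.2) : PolyTime fun a => (l a).map (f a) := by
  have := flatMap (f := fun a x => [f a x]) hl (hf.cons (const []))
  exact this.congr fun a => List.flatMap_pure_eq_map _ _

instance : DataCode Unit := ⟨fun _ => Data.nil⟩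

theorem code_replicate (n : ℕ) : code (List.replicate n ()) = code n := by
  simp [code, Data.ofNat]

theorem iterate {n : α → ℕ} {init : α → β} {step : α → β → β} (hn : PolyTime n)
    (hinit : PolyTime init) (hstep : PolyTime fun p : α × β => step p.1 p.2)
    {B : α → ℕ} (hB : PolyBounded B) (hsB : ∀ a acc, codeSize (step a acc) ≤ codeSize acc + B a) :
    PolyTime fun a => (step a)^[n a] (init a) := by
  have := foldl (l := fun a => List.replicate (n a) ())
    (step := fun p : α × β × Unit => step p.1 p.2.1) (hn.congr_code fun a => code_replicate _) hinit
    (hstep.comp (f := fun p : α × β × Unit => (p.1, p.2.1)) (by fun_prop)) hB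
    (fun a acc x _ => hsB a acc)
  refine this.congr fun a => ?_
  generalize n a = k
  generalize init a = acc
  induction k generalizing acc with
  | zero => rfl
  | succ k ih => rw [Function.iterate_succ_apply, ← ih]; rfl

@[fun_prop]
theorem pred {f : α → ℕ} (hf : PolyTime f) : PolyTime fun a => f a - 1 :=
  (hf.congr_code (f' := fun a => List.replicate (f a) ()) fun a => code_replicate _).tail.congr_code
    fun a => by rw [List.tail_replicate, code_replicate]

@[fun_prop]
theorem sub {f g : α → ℕ} (hf : PolyTime f) (hg : PolyTime g) : PolyTime fun a => f a - g a := by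
  have := iterate (step := fun _ k => k - 1) hg hf (.pred (by fun_prop)) (.const 0)
    (fun a acc => by simp)
  exact this.congr fun a => Nat.pred_iterate _ _

@[fun_prop]
theorem eqZero {f : α → ℕ} (hf : PolyTime f) : PolyTime fun a => decide (f a = 0) := by
  have := (hf.congr_code (f' := fun a => List.replicate (f a) ()) fun a =>
    code_replicate _).isEmpty
  refine this.congr fun a => ?_
  cases f a <;> rfl

@[fun_prop]
theorem natLe {f g : α → ℕ} (hf : PolyTime f) (hg : PolyTime g) :
    PolyTime fun a => decide (f a ≤ g a) := by
  simpa only [Nat.sub_eq_zero_iff_le] using (hf.sub hg).eqZero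

@[fun_prop]
theorem natEq {f g : α → ℕ} (hf : PolyTime f) (hg : PolyTime g) :
    PolyTime fun a => decide (f a = g a) := by
  simpa only [← Bool.decide_and, ← le_antisymm_iff] using (hf.natLe hg).and (hg.natLe hf)

@[fun_prop]
theorem add {f g : α → ℕ} (hf : PolyTime f) (hg : PolyTime g) : PolyTime fun a => f a + g a := by
  have := iterate (step := fun _ k => k + 1) hg hf (by fun_prop) (.const 1)
    (fun a acc => by simp)
  exact this.congr fun a => Nat.succ_iterate _ _

@[fun_prop]
theorem mul {f g : α → ℕ} (hf : PolyTime f) (hg : PolyTime g) :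
    PolyTime fun a => f a * g a := by
  have := iterate (step := fun a k => k + f a) hg (const 0)
    (.add (by fun_prop) (hf.comp (by fun_prop))) hf.1 (fun a acc => by simp)
  refine this.congr fun a => ?_
  generalize g a = n
  induction n with
  | zero => rfl
  | succ n ih => rw [Function.iterate_succ_apply', ih, mul_add, mul_one]

@[fun_prop]
theorem length {f : α → List β} (hf : PolyTime f) : PolyTime fun a => (f a).length := by
  have := foldr (step := fun _ _ k => k + 1) hf (const 0) (by fun_prop) (.const 1)
    (fun a x hx acc => by simp)
  refine this.congr fun a => ?_
  induction f a with
  | nil => rfl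
  | cons x l ih => simp [ih]

@[fun_prop]
theorem drop {f : α → List β} {g : α → ℕ} (hf : PolyTime f) (hg : PolyTime g) :
    PolyTime fun a => (f a).drop (g a) := by
  have := iterate (step := fun _ l => l.tail) hg hf (by fun_prop) (.const 0)
    (fun a acc => by simpa using codeSize_drop_le acc 1)
  simpa only [List.tail_iterate] using this

@[fun_prop]
theorem headD {f : α → List β} (hf : PolyTime f) (d : β) : PolyTime fun a => (f a).headD d := by
  have := foldr (step := fun _ x _ => x) hf (const d) (by fun_prop) hf.1
    (fun a x hx acc => (codeSize_le_of_mem hx).trans (by omega))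
  refine this.congr fun a => ?_
  cases f a <;> rfl

@[fun_prop]
theorem range {f : α → ℕ} (hf : PolyTime f) : PolyTime fun a => List.range (f a) := by
  have := iterate (init := fun _ => (0, ([] : List ℕ)))
    (step := fun a p => if p.1 ≤ f a then (p.1 + 1, p.2 ++ [p.1]) else p) hf (by fun_prop)
    (.ite (.natLe (by fun_prop) (hf.comp (by fun_prop)))
      (.prodMk (by fun_prop) (.append (by fun_prop) (by fun_prop))) (by fun_prop))
    (B := fun a => f a + 2) ((hf.1.mono fun a => by simp).add (.const 2))
    (fun a acc => by
      split_ifs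
      · obtain ⟨i, l⟩ := acc
        simp [codeSize_append] at *; omega
      · omega)
  have key : ∀ n k, k ≤ n + 1 →
      (fun p : ℕ × List ℕ => if p.1 ≤ n then (p.1 + 1, p.2 ++ [p.1]) else p)^[k] (0, []) =
        (k, List.range k) := by
    intro n k
    induction k with
    | zero => simp
    | succ k ih =>
      intro hk
      rw [Function.iterate_succ_apply', ih (by omega), if_pos (by simp; omega), List.range_succ]
  refine this.snd.congr fun a => ?_
  rw [key _ _ (by omega)]

@[fun_prop]
theorem tails {f : α → List β} (hf : PolyTime f) : PolyTime fun a => (f a).tails := by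
  have := map (f := fun a i => (f a).drop i) hf.length.succ.range
    (.drop (hf.comp (by fun_prop)) (by fun_prop))
  refine this.congr fun a => ?_
  induction f a with
  | nil => rfl
  | cons x l ih => rw [List.tails_cons, ← ih, List.length_cons, List.range_succ_eq_map]; simp

@[fun_prop]
theorem divMod {f g : α → ℕ} (hf : PolyTime f) (hg : PolyTime g) :
    PolyTime fun a => (f a / g a, f a % g a) := by
  have := iterate (init := fun _ => (0, 0))
    (step := fun a (p : ℕ × ℕ) => if p.2 + 1 = g a then (p.1 + 1, 0) else (p.1, p.2 + 1)) hf
    (by fun_prop)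
    (.ite (.natEq (by fun_prop) (hg.comp (by fun_prop))) (by fun_prop) (by fun_prop))
    (.const 1) (fun a acc => by
      split_ifs
      · obtain ⟨i, j⟩ := acc
        simp
      · obtain ⟨i, j⟩ := acc
        simp [← add_assoc])
  refine this.congr fun a => ?_
  generalize f a = n
  generalize g a = d
  induction n with
  | zero => simp
  | succ n ih =>
    rw [Function.iterate_succ_apply', ih]
    rcases Nat.eq_zero_or_pos d with rfl | hd
    · simp
    · have hlt := Nat.mod_lt n hd
      have hdm := Nat.div_add_mod n d
      split_ifs with h <;> symm <;> rw [Prod.mk.injEq, Nat.div_mod_unique hd] <;> dsimp only at *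
      · refine ⟨?_, hd⟩
        rw [mul_add]; omega
      · refine ⟨by omega, by omega⟩

@[fun_prop]
theorem testBit {f g : α → ℕ} (hf : PolyTime f) (hg : PolyTime g) :
    PolyTime fun a => (f a).testBit (g a) := by
  have := iterate (step := fun _ k => k / 2) hg hf (divMod (by fun_prop) (const 2)).fst (.const 0)
    (fun a acc => by simpa using Nat.div_le_self _ _)
  refine (natEq (this.divMod (const 2)).snd (const 1)).congr fun a => ?_
  dsimp only
  generalize g a = k
  generalize f a = n
  induction k generalizing n with
  | zero =>
    rw [Nat.testBit_zero]
    exact decide_eq_decide.2 Iff.rfl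
  | succ k ih => rw [Function.iterate_succ_apply, ih, Nat.testBit_succ]

theorem lookup {f : α → List (β × γ)} {c : α → β → Bool} (hf : PolyTime f)
    (hc : PolyTime fun p : α × β => c p.1 p.2) :
    PolyTime fun a => ((f a).find? fun p => c a p.1).map Prod.snd := by
  have := foldr (init := fun _ => (none : Option γ))
    (step := fun a x acc => bif c a x.1 then Option.some x.2 else acc) hf (const none)
    (.cond (hc.comp (f := fun p : α × Option γ × β × γ => (p.1, p.2.2.1)) (by fun_prop))
      (by fun_prop) (by fun_prop))
    (hf.1.add (.const 1)) (fun a x hx acc => by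
      have := codeSize_le_of_mem hx
      obtain ⟨y, z⟩ := x
      cases c a y
      · simp
      · have hs : codeSize (Option.some z) = codeSize z + 1 := by
          simp [codeSize, code_some, Data.size]
        simp [hs] at *; omega)
  refine this.congr fun a => ?_
  induction f a with
  | nil => rfl
  | cons x l ih =>
    rw [List.foldr_cons, ih, List.find?_cons]
    cases c a x.1 <;> rfl

end PolyTime

/-! ### Games given by lists of arcs -/

section ArcGame

variable {κ : Type*} [DecidableEq κ] {verts : List κ} {arcs : κ → List (κ × ℤ)}

/-- The weight that the list `A` of outgoing arcs assigns to the target `v`. -/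
def arcWeight (A : List (κ × ℤ)) (v : κ) : Option ℤ :=
  (A.find? fun p => decide (p.1 = v)).map Prod.snd

theorem arcWeight_cons (p : κ × ℤ) (A : List (κ × ℤ)) (v : κ) :
    arcWeight (p :: A) v = if p.1 = v then some p.2 else arcWeight A v := by
  unfold arcWeight
  rw [List.find?_cons]
  split_ifs with h <;> simp [h]

theorem mem_of_arcWeight_eq_some {A : List (κ × ℤ)} {v : κ} {z : ℤ} (h : arcWeight A v = some z) :
    (v, z) ∈ A := by
  induction A with
  | nil => simp [arcWeight] at h
  | cons p A ih =>
    rw [arcWeight_cons] at h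
    split_ifs at h with hp
    · cases h; simp [← hp]
    · exact List.mem_cons_of_mem _ (ih h)

theorem arcWeight_eq_none {A : List (κ × ℤ)} {v : κ} (h : v ∉ A.map Prod.fst) :
    arcWeight A v = none := by
  rw [Option.eq_none_iff_forall_not_mem]
  exact fun z hz => h (List.mem_map.2 ⟨_, mem_of_arcWeight_eq_some hz, rfl⟩)

/-- Conditions under which the lists of outgoing arcs describe a simple digraph on `verts`. -/
structure IsArcGame (verts : List κ) (arcs : κ → List (κ × ℤ)) : Prop where
  nodup_verts : verts.Nodup
  loopless : ∀ u ∈ verts, ∀ p ∈ arcs u, p.1 ≠ u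
  nodup_arcs : ∀ u ∈ verts, ((arcs u).map Prod.fst).Nodup
  mem_verts : ∀ u ∈ verts, ∀ p ∈ arcs u, p.1 ∈ verts

namespace IsArcGame

/-- The game on the vertices `verts` with the arcs `arcs`. -/
def game (h : IsArcGame verts arcs) : ASHG verts.length where
  arcs := Finset.univ.filter fun p => (arcWeight (arcs (verts.get p.1)) (verts.get p.2)).isSome
  loopless v hv := by
    rw [Finset.mem_filter] at hv
    obtain ⟨z, hz⟩ := Option.isSome_iff_exists.1 hv.2
    exact h.loopless _ (List.get_mem ..) _ (mem_of_arcWeight_eq_some hz) rfl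
  weight u v := (arcWeight (arcs (verts.get u)) (verts.get v)).getD 0
  weight_eq_zero u v huv := by
    rw [Finset.mem_filter, not_and] at huv
    have := huv (Finset.mem_univ _)
    rw [Bool.not_eq_true, Option.isSome_eq_false_iff, Option.isNone_iff_eq_none] at this
    rw [this, Option.getD_none]

theorem code_matrix (h : IsArcGame verts arcs) :
    code (verts.map fun u => verts.map fun v => arcWeight (arcs u) v) = h.game.encode := by
  have hget : ∀ {β : Type} (f : κ → β), verts.map f = List.ofFn fun i => f (verts.get i) := by
    intro β f
    conv_lhs => rw [← List.ofFn_get verts, List.map_ofFn]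
    rfl
  simp only [code, ASHG.encode, List.map_map]
  rw [hget]
  congr 2
  funext u
  simp only [Function.comp, List.map_map]
  rw [hget]
  congr 2
  funext v
  cases hz : arcWeight (arcs (verts.get u)) (verts.get v) <;>
    simp [game, hz, -List.get_eq_getElem]

theorem exists_arc_of_mem_arcs (h : IsArcGame verts arcs) {u v : Fin verts.length}
    (huv : (u, v) ∈ h.game.arcs) : ∃ p ∈ arcs (verts.get u), p.1 = verts.get v := by
  rw [game, Finset.mem_filter] at huv
  obtain ⟨z, hz⟩ := Option.isSome_iff_exists.1 huv.2
  exact ⟨_, mem_of_arcWeight_eq_some hz, rfl⟩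

theorem exists_arc_of_adj (h : IsArcGame verts arcs) {u v : Fin verts.length}
    (huv : h.game.underlying.Adj u v) :
    (∃ p ∈ arcs (verts.get u), p.1 = verts.get v) ∨
      ∃ p ∈ arcs (verts.get v), p.1 = verts.get u := by
  rw [ASHG.underlying, SimpleGraph.fromRel_adj] at huv
  exact huv.2.imp h.exists_arc_of_mem_arcs h.exists_arc_of_mem_arcs

theorem absWeightLE (h : IsArcGame verts arcs) {W : ℕ}
    (hW : ∀ u ∈ verts, ∀ p ∈ arcs u, |p.2| ≤ W) : h.game.AbsWeightLE W := by
  intro u v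
  simp only [game]
  cases hz : arcWeight (arcs (verts.get u)) (verts.get v) with
  | none => simp
  | some z => exact hW _ (List.get_mem ..) _ (mem_of_arcWeight_eq_some hz)

/-- The lists `N u` contain all neighbours of `u`. -/
theorem maxDegreeLE (h : IsArcGame verts arcs) {Δ : ℕ} (N : κ → List κ)
    (hN : ∀ u ∈ verts, (N u).length ≤ Δ) (hout : ∀ u ∈ verts, ∀ p ∈ arcs u, p.1 ∈ N u)
    (hin : ∀ u ∈ verts, ∀ p ∈ arcs u, u ∈ N p.1) : h.game.MaxDegreeLE Δ := by
  intro v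
  refine le_trans ?_ (hN (verts.get v) (List.get_mem ..))
  refine le_trans ?_ (List.toFinset_card_le (N (verts.get v)))
  rw [← Set.ncard_coe_finset]
  refine Set.ncard_le_ncard_of_injOn verts.get (fun u hu => ?_)
    (List.nodup_iff_injective_get.1 h.nodup_verts).injOn (Finset.finite_toSet _)
  rw [List.coe_toFinset, Set.mem_ofPred_eq]
  rcases h.exists_arc_of_adj hu with ⟨p, hp, he⟩ | ⟨p, hp, he⟩
  · exact he ▸ hout _ (List.get_mem ..) p hp
  · exact he ▸ hin _ (List.get_mem ..) p hp

/-- If the vertices have levels such that all arcs stay in a level or descend by one level, then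
pairs of consecutive levels form a path decomposition. -/
theorem pathwidth_le (h : IsArcGame verts arcs) {S : ℕ} (lev : κ → ℕ)
    (hlev : ∀ u ∈ verts, ∀ p ∈ arcs u, lev u = lev p.1 ∨ lev u = lev p.1 + 1)
    (hS : ∀ t, (verts.filter fun v => lev v = t).length ≤ S) :
    pathwidth h.game.underlying ≤ 2 * S := by
  have hcard : ∀ t, (Finset.univ.filter fun u => lev (verts.get u) = t).card ≤ S := by
    intro t
    refine le_trans ?_ (hS t)
    rw [← List.toFinset_card_of_nodup (h.nodup_verts.filter _)]
    refine Finset.card_le_card_of_injOn verts.get (fun u hu => ?_)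
      (List.nodup_iff_injective_get.1 h.nodup_verts).injOn
    simpa using hu
  refine Nat.sInf_le ⟨⟨(Finset.univ.sup fun u => lev (verts.get u)) + 1, fun i =>
    (Finset.univ.filter fun u => lev (verts.get u) = i) ∪
      Finset.univ.filter fun u => lev (verts.get u) = i + 1, ?_, ?_, ?_⟩, fun i => ?_⟩
  · intro v
    exact ⟨⟨lev (verts.get v), Nat.lt_succ_of_le
      (Finset.le_sup (f := fun u => lev (verts.get u)) (Finset.mem_univ v))⟩, by simp⟩
  · intro u v huv
    rcases h.exists_arc_of_adj huv with ⟨p, hp, he⟩ | ⟨p, hp, he⟩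
    · refine ⟨⟨lev (verts.get v), Nat.lt_succ_of_le
        (Finset.le_sup (f := fun u => lev (verts.get u)) (Finset.mem_univ v))⟩, ?_⟩
      have := hlev _ (List.get_mem ..) p hp
      rw [he] at this
      simpa [-List.get_eq_getElem] using this
    · refine ⟨⟨lev (verts.get u), Nat.lt_succ_of_le
        (Finset.le_sup (f := fun u => lev (verts.get u)) (Finset.mem_univ u))⟩, ?_⟩
      have := hlev _ (List.get_mem ..) p hp
      rw [he] at this
      simpa [-List.get_eq_getElem] using this
  · intro i j k hij hjk v hi hk
    have hij' : (i : ℕ) ≤ j := hij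
    have hjk' : (j : ℕ) ≤ k := hjk
    simp only [Finset.mem_union, Finset.mem_filter, Finset.mem_univ, true_and] at *
    omega
  · refine (Finset.card_union_le _ _).trans ?_
    have := hcard i
    have := hcard (i + 1)
    simp only at *
    omega

end IsArcGame

/-- The utility of `v` for the colour class `k` of the colouring `c`. -/
def gain (arcs : κ → List (κ × ℤ)) (c : κ → ℕ) (v : κ) (k : ℕ) : ℤ :=
  ((arcs v).map fun p => if c p.1 = k then p.2 else 0).sum

/-- Nash stability of the partition into colour classes. -/
def IsStableColoring (verts : List κ) (arcs : κ → List (κ × ℤ)) (c : κ → ℕ) : Prop :=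
  ∀ v ∈ verts, 0 ≤ gain arcs c v (c v) ∧ ∀ k, gain arcs c v k ≤ gain arcs c v (c v)

/-- A sum over all vertices of the weights from one vertex is a sum over its list of arcs. -/
theorem sum_arcWeight (hv : verts.Nodup) {A : List (κ × ℤ)} (hA : (A.map Prod.fst).Nodup)
    (hmem : ∀ p ∈ A, p.1 ∈ verts) (P : κ → Prop) [DecidablePred P] :
    ∑ u : Fin verts.length, (if P (verts.get u) then (arcWeight A (verts.get u)).getD 0 else 0) =
      (A.map fun p => if P p.1 then p.2 else 0).sum := by
  have hsum : ∀ F : κ → ℤ, ∑ u : Fin verts.length, F (verts.get u) = ∑ x ∈ verts.toFinset, F x := by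
    intro F
    rw [List.sum_toFinset _ hv, ← List.sum_ofFn]
    conv_rhs => rw [← List.ofFn_get verts, List.map_ofFn]
    rfl
  rw [hsum fun x => if P x then (arcWeight A x).getD 0 else 0]
  induction A with
  | nil => simp [arcWeight]
  | cons p A ih =>
    rw [List.map_cons, List.nodup_cons] at hA
    rw [List.map_cons, List.sum_cons, ← ih hA.2 fun q hq => hmem q (List.mem_cons_of_mem _ hq)]
    have hp : p.1 ∈ verts.toFinset := List.mem_toFinset.2 (hmem p List.mem_cons_self)
    have hsplit : ∀ x, (if P x then (arcWeight (p :: A) x).getD 0 else 0) =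
        (if p.1 = x then (if P p.1 then p.2 else 0) else 0) +
          if P x then (arcWeight A x).getD 0 else 0 := by
      intro x
      rw [arcWeight_cons]
      by_cases hx : p.1 = x
      · subst hx
        rw [arcWeight_eq_none hA.1]
        simp
      · simp [hx]
    rw [Finset.sum_congr rfl fun x _ => hsplit x, Finset.sum_add_distrib, Finset.sum_ite_eq,
      if_pos hp]

namespace IsArcGame

theorem utility_eq_gain (h : IsArcGame verts arcs) (c : κ → ℕ) (v : Fin verts.length) (k : ℕ) :
    h.game.utility v (Finset.univ.filter fun u => c (verts.get u) = k) =
      gain arcs c (verts.get v) k := by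
  have hv : h.game.weight v v = 0 := h.game.weight_eq_zero _ _ (h.game.loopless v)
  rw [ASHG.utility, Finset.sum_erase _ hv, Finset.sum_filter, gain,
    ← sum_arcWeight h.nodup_verts (h.nodup_arcs _ (List.get_mem ..))
      (h.mem_verts _ (List.get_mem ..)) fun x => c x = k]
  rfl

theorem hasNashStablePartition_iff (h : IsArcGame verts arcs) :
    h.game.HasNashStablePartition ↔ ∃ c, IsStableColoring verts arcs c := by
  constructor
  · rintro ⟨π, hπ⟩
    obtain ⟨c, hc⟩ : ∃ c : κ → ℕ, ∀ u, c (verts.get u) = Encodable.encode (π.part u) := by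
      refine ⟨fun x => if hx : x ∈ verts then
        Encodable.encode (π.part ⟨verts.idxOf x, List.idxOf_lt_length_of_mem hx⟩) else 0, fun u => ?_⟩
      refine (dif_pos (List.get_mem verts u)).trans ?_
      congr 2
      exact Fin.ext (List.get_idxOf h.nodup_verts u)
    have hfilter : ∀ u : Fin verts.length,
        (Finset.univ.filter fun w => c (verts.get w) = c (verts.get u)) = π.part u := by
      intro u
      ext w
      rw [Finset.mem_filter, hc, hc, Encodable.encode_inj]
      simp only [Finset.mem_univ, true_and]
      rw [← π.part_eq_iff_mem (π.part_mem.2 (Finset.mem_univ u))]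
    refine ⟨c, fun x hx => ?_⟩
    obtain ⟨v, rfl⟩ := List.get_of_mem hx
    obtain ⟨h0, h1⟩ := hπ v (π.part v) (π.part_mem.2 (Finset.mem_univ v))
      (π.mem_part (Finset.mem_univ v))
    rw [← hfilter, h.utility_eq_gain] at h0
    refine ⟨h0, fun k => ?_⟩
    rw [← h.utility_eq_gain]
    rcases (Finset.univ.filter fun w => c (verts.get w) = k).eq_empty_or_nonempty with he | ⟨w, hw⟩
    · rw [he]
      simpa [ASHG.utility] using h0
    · rw [Finset.mem_filter] at hw
      have := h1 (π.part w) (π.part_mem.2 (Finset.mem_univ w))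
      rwa [← hfilter, ← hfilter, h.utility_eq_gain c v (c (verts.get v)), hw.2] at this
  · rintro ⟨c, hc⟩
    classical
    set π := Finpartition.ofSetoid (Setoid.ker fun u : Fin verts.length => c (verts.get u)) with hπ
    have hpart : ∀ S ∈ π.parts, ∀ v ∈ S,
        S = Finset.univ.filter fun u => c (verts.get u) = c (verts.get v) := by
      intro S hS v hv
      rw [← π.part_eq_of_mem hS hv]
      ext w
      rw [hπ, Finpartition.mem_part_ofSetoid_iff_rel, Finset.mem_filter]
      simp [Setoid.ker_def, eq_comm, -List.get_eq_getElem]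
    refine ⟨π, fun v S hS hv => ?_⟩
    obtain ⟨h0, h1⟩ := hc _ (List.get_mem verts v)
    rw [hpart S hS v hv, h.utility_eq_gain]
    refine ⟨h0, fun S' hS' => ?_⟩
    obtain ⟨w, hw⟩ := π.nonempty_of_mem_parts hS'
    rw [hpart S' hS' w hw, h.utility_eq_gain]
    exact h1 _

end IsArcGame

end ArcGame

/-! ### Circuits of coalition tests -/

/-- An operation on wires: `(true, α, β)` records whether the wires `α` and `β` lie in the same
coalition, `(false, α, β)` enforces that they do not. -/
abbrev WireOp := Bool × ℕ × ℕ

/-- A vertex `(s, r)` is the vertex number `r` in the time slice after the operations `s`, where the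
last operation is the head of `s`. The numbers `0, 1, 2, 3` are those of the flag, the gadget, the
guard of the gadget, and the base wire; the ordinary wires have numbers from `3` on. The flag lies
in the coalition of the base wire unless a test has succeeded since the last enforcement. -/
abbrev WireVertex := List WireOp × ℕ

/-- The outgoing arcs of a vertex. The gadget of a test joins the wires `α` and `β` if these are
together and the base wire otherwise (`β` is never with the base wire); the flag of a test joins the
base wire if and only if its predecessor and the gadget are both there. The flag of an enforcement
returns to the base wire. The gadget of an enforcement is content only in the coalition of `α`,
and there only if `β` is elsewhere. Every ordinary wire follows its predecessor. -/
def wireArcs : WireVertex → List (WireVertex × ℤ)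
  | ([], _) => []
  | (o :: p, r) =>
    if r = 0 then
      if o.1 = true then [((p, 0), 1), ((p, 3), -1), ((o :: p, 1), 1)] else [((p, 3), 1)]
    else if r = 1 then
      if o.1 = true then [((p, o.2.1), 2), ((p, o.2.2), 2), ((p, 3), 3)]
      else [((p, o.2.1), 1), ((p, o.2.2), -1), ((o :: p, 2), -1)]
    else if r = 2 then [((o :: p, 1), 1)]
    else [((p, r), 1)]

theorem wireArcs_cons (o : WireOp) (p : List WireOp) (r : ℕ) : wireArcs (o :: p, r) =
    if r = 0 then
      if o.1 = true then [((p, 0), 1), ((p, 3), -1), ((o :: p, 1), 1)] else [((p, 3), 1)]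
    else if r = 1 then
      if o.1 = true then [((p, o.2.1), 2), ((p, o.2.2), 2), ((p, 3), 3)]
      else [((p, o.2.1), 1), ((p, o.2.2), -1), ((o :: p, 2), -1)]
    else if r = 2 then [((o :: p, 1), 1)]
    else [((p, r), 1)] := rfl

/-- The vertices of the game: `S` vertices for every final segment of the list of operations. -/
def wireVerts (L : List WireOp) (S : ℕ) : List WireVertex :=
  L.tails.flatMap fun s => (List.range S).map fun r => (s, r)

theorem mem_wireVerts {L : List WireOp} {S : ℕ} {v : WireVertex} :
    v ∈ wireVerts L S ↔ v.1 <:+ L ∧ v.2 < S := by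
  obtain ⟨s, r⟩ := v
  simp [wireVerts]

theorem nodup_tails {α : Type*} (l : List α) : l.tails.Nodup := by
  induction l with
  | nil => simp
  | cons a l ih =>
    rw [List.tails_cons, List.nodup_cons, List.mem_tails]
    exact ⟨fun h => by simpa using h.length_le, ih⟩

/-- The base wire exists, the operations compare distinct existing vertices of a slice, and tests
compare ordinary wires other than the base wire. -/
def WellFormed (L : List WireOp) (S : ℕ) : Prop :=
  3 < S ∧ ∀ o ∈ L, o.2.1 < S ∧ o.2.2 < S ∧ o.2.1 ≠ o.2.2 ∧
    (o.1 = true → 3 < o.2.1 ∧ 3 < o.2.2)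

theorem eq_of_suffix_of_length_eq {α : Type*} {s s' l : List α} (hs : s <:+ l) (hs' : s' <:+ l)
    (h : s.length = s'.length) : s = s' :=
  (List.suffix_of_suffix_length_le hs hs' h.le).eq_of_length h

section WireGame

variable {L : List WireOp} {S : ℕ}

theorem isArcGame_wire (h : WellFormed L S) : IsArcGame (wireVerts L S) wireArcs where
  nodup_verts := by
    rw [wireVerts]
    exact (nodup_tails L).product List.nodup_range
  loopless := by
    rintro ⟨s, r⟩ - p hp
    rcases s with _ | ⟨o, s⟩
    · simp [wireArcs] at hp
    · have hne : s ≠ o :: s := fun h => by simpa using congrArg List.length h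
      rw [wireArcs_cons] at hp
      intro he
      split_ifs at hp <;> simp only [List.mem_cons, List.not_mem_nil, or_false] at hp <;>
        rcases hp with rfl | rfl | rfl <;> simp_all
  nodup_arcs := by
    rintro ⟨s, r⟩ hv
    rw [mem_wireVerts] at hv
    rcases s with _ | ⟨o, s⟩
    · simp [wireArcs]
    · have hne : s ≠ o :: s := fun h => by simpa using congrArg List.length h
      obtain ⟨-, -, h3, h4⟩ := h.2 o (hv.1.subset List.mem_cons_self)
      rw [wireArcs_cons]
      split_ifs <;> simp_all
      omega
  mem_verts := by
    rintro ⟨s, r⟩ hv p hp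
    rw [mem_wireVerts] at hv ⊢
    rcases s with _ | ⟨o, s⟩
    · simp [wireArcs] at hp
    · obtain ⟨h1, h2, -⟩ := h.2 o (hv.1.subset List.mem_cons_self)
      have hs : s <:+ L := (List.suffix_cons o s).trans hv.1
      have hS := h.1
      have hr : r < S := hv.2
      have ho := hv.1
      rw [wireArcs_cons] at hp
      split_ifs at hp <;> simp only [List.mem_cons, List.not_mem_nil, or_false] at hp <;>
        rcases hp with rfl | rfl | rfl <;> refine ⟨by assumption, ?_⟩ <;> dsimp only <;> omega

/-- The arcs stay in a time slice or lead to the preceding one. -/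
theorem wireArcs_level (u : WireVertex) : ∀ p ∈ wireArcs u,
    p.1.1 = u.1 ∨ ∃ o, u.1 = o :: p.1.1 := by
  obtain ⟨s, r⟩ := u
  rcases s with _ | ⟨o, s⟩
  · simp [wireArcs]
  · intro p hp
    rw [wireArcs_cons] at hp
    split_ifs at hp <;> simp only [List.mem_cons, List.not_mem_nil, or_false] at hp <;>
      rcases hp with rfl | rfl | rfl <;> simp

theorem pathwidth_wire_le (h : WellFormed L S) :
    pathwidth (isArcGame_wire h).game.underlying ≤ 2 * S := by
  refine (isArcGame_wire h).pathwidth_le (fun v => v.1.length) (fun u _ p hp => ?_) fun t => ?_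
  · rcases wireArcs_level u p hp with h | ⟨o, h⟩ <;> simp [h]
  · have hnd := (isArcGame_wire h).nodup_verts.filter fun v => decide (v.1.length = t)
    suffices hsub : (((wireVerts L S).filter fun v => decide (v.1.length = t)).map Prod.snd).Subperm
        (List.range S) by simpa using hsub.length_le
    refine List.Nodup.subperm (List.Nodup.map_on ?_ hnd) ?_
    · rintro ⟨s, r⟩ hx ⟨s', r'⟩ hy hr
      simp only [List.mem_filter, mem_wireVerts, decide_eq_true_eq] at hx hy
      rw [Prod.mk.injEq]
      exact ⟨eq_of_suffix_of_length_eq hx.1.1 hy.1.1 (hx.2.trans hy.2.symm), hr⟩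
    · intro r hr
      simp only [List.mem_map, List.mem_filter, mem_wireVerts] at hr
      obtain ⟨x, hx, rfl⟩ := hr
      exact List.mem_range.2 hx.1.2

theorem absWeightLE_wire (h : WellFormed L S) : (isArcGame_wire h).game.AbsWeightLE 3 := by
  refine (isArcGame_wire h).absWeightLE fun u _ p hp => ?_
  obtain ⟨s, r⟩ := u
  rcases s with _ | ⟨o, s⟩
  · simp [wireArcs] at hp
  · rw [wireArcs_cons] at hp
    split_ifs at hp <;> simp only [List.mem_cons, List.not_mem_nil, or_false] at hp <;>
      rcases hp with rfl | rfl | rfl <;> simp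

theorem maxDegreeLE_wire (h : WellFormed L S) : (isArcGame_wire h).game.MaxDegreeLE 12 := by
  -- the time slice after `s`
  obtain ⟨next, hn⟩ : ∃ next : List WireOp → List WireOp,
      ∀ o s, o :: s <:+ L → next s = o :: s := by
    refine ⟨fun s => L.drop (L.length - (s.length + 1)), fun o s hs => ?_⟩
    refine eq_of_suffix_of_length_eq (List.drop_suffix _ _) hs ?_
    have := hs.length_le
    rw [List.length_cons] at this
    rw [List.length_drop, List.length_cons]
    omega
  refine (isArcGame_wire h).maxDegreeLE (fun v => [(v.1.tail, 0), (v.1.tail, 3), (v.1.tail, v.2),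
    (v.1.tail, (v.1.headD (false, 0, 0)).2.1), (v.1.tail, (v.1.headD (false, 0, 0)).2.2), (v.1, 0),
    (v.1, 1), (v.1, 2), (next v.1, 0), (next v.1, 1), (next v.1, 2), (next v.1, v.2)])
    (fun _ _ => by simp) ?_ ?_
  · rintro ⟨s, r⟩ - p hp
    rcases s with _ | ⟨o, s⟩
    · simp [wireArcs] at hp
    · rw [wireArcs_cons] at hp
      split_ifs at hp <;> simp only [List.mem_cons, List.not_mem_nil, or_false] at hp <;>
        rcases hp with rfl | rfl | rfl <;> simp
  · rintro ⟨s, r⟩ hv p hp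
    rw [mem_wireVerts] at hv
    rcases s with _ | ⟨o, s⟩
    · simp [wireArcs] at hp
    · have := hn o s hv.1
      rw [wireArcs_cons] at hp
      split_ifs at hp <;> simp only [List.mem_cons, List.not_mem_nil, or_false] at hp <;>
        rcases hp with rfl | rfl | rfl <;> simp [*]

/-! ### Stable colourings of a circuit -/

section Sound

variable {c : WireVertex → ℕ} (hc : IsStableColoring (wireVerts L S) wireArcs c)
include hc

theorem IsStableColoring.wire {o : WireOp} {p : List WireOp} {r : ℕ} (hs : o :: p <:+ L)
    (h3 : 3 ≤ r) (hr : r < S) : c (o :: p, r) = c (p, r) := by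
  obtain ⟨-, h1⟩ := hc (o :: p, r) (mem_wireVerts.2 ⟨hs, hr⟩)
  have := h1 (c (p, r))
  simp only [gain, wireArcs, show r ≠ 0 by omega, show r ≠ 1 by omega, show r ≠ 2 by omega,
    if_false, List.map_cons, List.map_nil, List.sum_cons, List.sum_nil, if_true] at this
  by_contra hne
  rw [if_neg (Ne.symm hne)] at this
  omega

theorem IsStableColoring.wire_const {s : List WireOp} {r : ℕ} (hs : s <:+ L)
    (h3 : 3 ≤ r) (hr : r < S) : c (s, r) = c ([], r) := by
  induction s with
  | nil => rfl
  | cons o p ih => rw [hc.wire hs h3 hr, ih ((List.suffix_cons o p).trans hs)]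

theorem IsStableColoring.flag_reset {α β : ℕ} {p : List WireOp} (hS : 3 < S)
    (hs : (false, α, β) :: p <:+ L) : c ((false, α, β) :: p, 0) = c ([], 3) := by
  obtain ⟨-, h1⟩ := hc ((false, α, β) :: p, 0) (mem_wireVerts.2 ⟨hs, by dsimp only; omega⟩)
  have := h1 (c (p, 3))
  simp only [gain, wireArcs, if_true, reduceCtorEq, if_false, List.map_cons, List.map_nil,
    List.sum_cons, List.sum_nil] at this
  rw [← hc.wire_const ((List.suffix_cons _ p).trans hs) le_rfl hS]
  by_contra hne
  rw [if_neg (Ne.symm hne)] at this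
  omega

/-- An enforced difference holds: the guard of the gadget lies in the coalition of the gadget and
costs it `1`, which only the first wire can make up for, and only in the absence of the second. -/
theorem IsStableColoring.ne_of_enforce {α β : ℕ} {p : List WireOp} (hS : 3 < S)
    (hs : (false, α, β) :: p <:+ L) : c (p, α) ≠ c (p, β) := by
  obtain ⟨-, h2⟩ := hc ((false, α, β) :: p, 2) (mem_wireVerts.2 ⟨hs, by dsimp only; omega⟩)
  obtain ⟨h0, -⟩ := hc ((false, α, β) :: p, 1) (mem_wireVerts.2 ⟨hs, by dsimp only; omega⟩)
  have h2 := h2 (c ((false, α, β) :: p, 1))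
  simp [gain, wireArcs] at h0 h2
  intro heq
  rw [heq] at h0
  generalize c (p, β) = x at *
  generalize c ((false, α, β) :: p, 1) = y at *
  generalize c ((false, α, β) :: p, 2) = z at *
  split_ifs at h0 h2 <;> omega

theorem IsStableColoring.flag_test {α β : ℕ} {p : List WireOp} (hw : WellFormed L S)
    (hs : (true, α, β) :: p <:+ L) (hflag : c (p, 0) = c ([], 3))
    (hβ : c ([], β) ≠ c ([], 3)) (hne : c ([], α) ≠ c ([], β)) :
    c ((true, α, β) :: p, 0) = c ([], 3) := by
  have hS := hw.1
  obtain ⟨hα, hβS, -, h4⟩ := hw.2 _ (hs.subset List.mem_cons_self)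
  have hp := (List.suffix_cons _ p).trans hs
  obtain ⟨-, h1⟩ := hc ((true, α, β) :: p, 1) (mem_wireVerts.2 ⟨hs, by dsimp only; omega⟩)
  obtain ⟨-, h0⟩ := hc ((true, α, β) :: p, 0) (mem_wireVerts.2 ⟨hs, by dsimp only; omega⟩)
  have h1 := h1 (c ([], 3))
  have h0 := h0 (c ([], 3))
  dsimp only at hα hβS h4
  simp only [gain, wireArcs_cons, hc.wire_const hp le_rfl hS, hc.wire_const hp (h4 rfl).1.le hα,
    hc.wire_const hp (h4 rfl).2.le hβS, hflag, if_true, one_ne_zero, if_false, List.map_cons,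
    List.map_nil, List.sum_cons, List.sum_nil] at h0 h1
  -- the gadget joins the base wire because the two wires differ, and the flag follows it
  generalize c ([], α) = a at *
  generalize c ([], β) = b at *
  generalize c ([], 3) = f at *
  generalize c ((true, α, β) :: p, 1) = g at *
  generalize c ((true, α, β) :: p, 0) = z at *
  obtain rfl : g = f := by
    by_contra hg
    split_ifs at h1 <;> omega
  by_contra hz
  split_ifs at h0 <;> omega

/-- If no test succeeds, then the flag of a stable colouring stays in the coalition of the base
wire. -/
theorem IsStableColoring.flag_tests (hw : WellFormed L S) {tests : List WireOp} {p : List WireOp}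
    (hs : tests ++ p <:+ L) (hp : c (p, 0) = c ([], 3))
    (ht : ∀ o ∈ tests, o.1 = true ∧ c ([], o.2.2) ≠ c ([], 3) ∧ c ([], o.2.1) ≠ c ([], o.2.2)) :
    c (tests ++ p, 0) = c ([], 3) := by
  induction tests with
  | nil => exact hp
  | cons o tests ih =>
    obtain ⟨b, α, β⟩ := o
    obtain ⟨rfl, h1, h2⟩ := ht _ List.mem_cons_self
    exact hc.flag_test hw hs (ih ((List.suffix_cons _ _).trans hs) fun o ho =>
      ht o (List.mem_cons_of_mem _ ho)) h1 h2

end Sound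

/-- The colours of the flags, for the colours `A` of the wires. -/
def flagColor (A : ℕ → ℕ) : List WireOp → ℕ
  | [] => A 3
  | (b, α, β) :: p =>
    if b = true then if A α = A β ∧ flagColor A p = A 3 then A α else flagColor A p else A 3

/-- The colours of the gadgets and their guards, for the colours `A` of the wires. The gadget of an
enforcement joins the first wire, which may be the flag. -/
def gadgetColor (A : ℕ → ℕ) : List WireOp → ℕ
  | [] => A 3
  | (b, α, β) :: p =>
    if b = true then if A α = A β then A α else A 3
    else if α = 0 then flagColor A p else A α

/-- The colouring of a circuit in which the wires have the colours `A`. -/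
def circuitColor (A : ℕ → ℕ) (v : WireVertex) : ℕ :=
  if v.2 = 0 then flagColor A v.1 else if v.2 = 1 ∨ v.2 = 2 then gadgetColor A v.1 else A v.2

theorem circuitColor_flag (A : ℕ → ℕ) (s : List WireOp) :
    circuitColor A (s, 0) = flagColor A s := rfl

theorem circuitColor_one (A : ℕ → ℕ) (s : List WireOp) :
    circuitColor A (s, 1) = gadgetColor A s := rfl

theorem circuitColor_two (A : ℕ → ℕ) (s : List WireOp) :
    circuitColor A (s, 2) = gadgetColor A s := rfl

theorem circuitColor_wire (A : ℕ → ℕ) (s : List WireOp) {r : ℕ} (hr : 3 ≤ r) :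
    circuitColor A (s, r) = A r := by
  rw [circuitColor, if_neg (by dsimp only; omega), if_neg (by dsimp only; omega)]

/-- The colouring is stable if the enforced differences hold and no anchor of a test, its second
wire, has the colour of the base wire. The first wire of an enforcement may be the flag. -/
theorem isStableColoring_circuitColor {A : ℕ → ℕ} (hw : WellFormed L S)
    (htest : ∀ o ∈ L, o.1 = true → A o.2.2 ≠ A 3)
    (henf : ∀ α β p, (false, α, β) :: p <:+ L → 3 ≤ β ∧ (α = 0 ∧ flagColor A p ≠ A β ∨
      3 ≤ α ∧ A α ≠ A β)) :
    IsStableColoring (wireVerts L S) wireArcs (circuitColor A) := by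
  rintro ⟨s, r⟩ hv
  rw [mem_wireVerts] at hv
  rcases s with _ | ⟨⟨b, α, β⟩, p⟩
  · simp [gain, wireArcs]
  obtain ⟨hs, -⟩ := hv
  have hw' := hw.2 _ (hs.subset List.mem_cons_self)
  by_cases hr0 : r = 0
  · subst hr0
    cases b with
    | false =>
      simp only [gain, wireArcs_cons, if_true, reduceCtorEq, if_false, List.map_cons, List.map_nil,
        List.sum_cons, List.sum_nil, circuitColor_wire A _ le_rfl, circuitColor_flag, flagColor]
      refine ⟨by omega, fun k => ?_⟩
      split_ifs <;> omega
    | true =>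
      have h1 := htest _ (hs.subset List.mem_cons_self) rfl
      simp only [gain, wireArcs_cons, if_true, List.map_cons, List.map_nil,
        List.sum_cons, List.sum_nil, circuitColor_wire A _ le_rfl, circuitColor_flag,
        circuitColor_one, flagColor, gadgetColor]
      dsimp only at h1
      by_cases hab : A α = A β <;> by_cases hz : flagColor A p = A 3 <;>
        simp only [hab, hz, and_true, and_false, if_true, if_false] <;>
        refine ⟨by grind, fun k => by split_ifs <;> omega⟩
  by_cases hr1 : r = 1
  · subst hr1
    cases b with
    | false =>
      obtain ⟨hβ, hα⟩ := henf _ _ _ hs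
      have hcα : circuitColor A (p, α) = gadgetColor A ((false, α, β) :: p) := by
        rcases hα with ⟨rfl, -⟩ | ⟨hα, -⟩
        · rfl
        · rw [circuitColor_wire A _ hα]
          simp [gadgetColor, show α ≠ 0 by omega]
      have hne : gadgetColor A ((false, α, β) :: p) ≠ A β := by
        rw [← hcα]
        rcases hα with ⟨rfl, hα⟩ | ⟨h3, hα⟩
        · exact hα
        · rwa [circuitColor_wire A _ h3]
      simp only [gain, wireArcs_cons, if_true, one_ne_zero, reduceCtorEq, if_false, List.map_cons,
        List.map_nil, List.sum_cons, List.sum_nil, circuitColor_wire A _ hβ, circuitColor_one,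
        circuitColor_two, hcα]
      refine ⟨?_, fun k => ?_⟩
      · split_ifs <;> omega
      · split_ifs <;> omega
    | true =>
      have h4 := hw'.2.2.2 rfl
      have h1 := htest _ (hs.subset List.mem_cons_self) rfl
      dsimp only at h4 h1
      simp only [gain, wireArcs_cons, if_true, one_ne_zero, if_false, List.map_cons,
        List.map_nil, List.sum_cons, List.sum_nil, circuitColor_wire A _ h4.1.le,
        circuitColor_wire A _ h4.2.le, circuitColor_wire A _ le_rfl, circuitColor_one, gadgetColor]
      generalize A α = a at *
      generalize A β = b at *
      generalize A 3 = f at *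
      refine ⟨?_, fun k => ?_⟩
      · split_ifs <;> omega
      · split_ifs <;> omega
  by_cases hr2 : r = 2
  · subst hr2
    simp only [gain, wireArcs_cons, show (2 : ℕ) ≠ 0 by decide, show (2 : ℕ) ≠ 1 by decide, if_true,
      if_false, List.map_cons, List.map_nil, List.sum_cons, List.sum_nil, circuitColor_one,
      circuitColor_two]
    refine ⟨by omega, fun k => ?_⟩
    split_ifs <;> omega
  · simp only [gain, wireArcs_cons, hr0, hr1, hr2, if_true,
      if_false, List.map_cons, List.map_nil, List.sum_cons, List.sum_nil,
      circuitColor_wire A _ (show 3 ≤ r by omega)]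
    refine ⟨by omega, fun k => ?_⟩
    split_ifs <;> omega

/-- A successful test moves the flag away from the base wire. -/
theorem flagColor_append_ne {A : ℕ → ℕ} {tests p : List WireOp} (h : ∀ o ∈ tests, o.1 = true)
    {o : WireOp} (ho : o ∈ tests) (hA : A o.2.1 = A o.2.2) (hF : A o.2.1 ≠ A 3)
    (hF' : ∀ o ∈ tests, A o.2.2 ≠ A 3) :
    flagColor A (tests ++ p) ≠ A 3 := by
  induction tests with
  | nil => simp at ho
  | cons o' tests ih =>
    obtain ⟨b, α, β⟩ := o'
    obtain rfl : b = true := h _ List.mem_cons_self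
    have h2 := hF' _ List.mem_cons_self
    have ih := ih (fun o ho => h o (List.mem_cons_of_mem _ ho))
    simp only [List.cons_append, flagColor, if_true]
    dsimp only at h2
    rcases List.mem_cons.1 ho with rfl | ho
    · dsimp only at hA hF
      split_ifs <;> grind
    · have := ih ho fun o ho => hF' o (List.mem_cons_of_mem _ ho)
      split_ifs <;> grind

end WireGame

/-! ### The game of a formula -/

/-- A step of the computation of `blockParams`. -/
def blockStep (n : ℕ) (x : ℕ × ℕ) : ℕ × ℕ := if x.2 * x.2 ≤ n then (x.1 + 1, x.2 + x.2) else x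

/-- The length `ℓ` of the blocks of variables and the number `q = 2 ^ ℓ` of assignments to a block,
where `q ^ 2` is the least power of `4` above `n`. -/
def blockParams (n : ℕ) : ℕ × ℕ := (blockStep n)^[n] (0, 1)

theorem blockStep_iterate (n k : ℕ) :
    ((blockStep n)^[k] (0, 1)).2 = 2 ^ ((blockStep n)^[k] (0, 1)).1 ∧
      (1 ≤ n → ((blockStep n)^[k] (0, 1)).2 * ((blockStep n)^[k] (0, 1)).2 ≤ 4 * n) ∧
      (n < ((blockStep n)^[k] (0, 1)).2 * ((blockStep n)^[k] (0, 1)).2 ∨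
        ((blockStep n)^[k] (0, 1)).1 = k) := by
  induction k with
  | zero => simp; omega
  | succ k ih =>
    rw [Function.iterate_succ_apply']
    generalize (blockStep n)^[k] (0, 1) = x at *
    obtain ⟨h1, h2, h3⟩ := ih
    rw [blockStep]
    split_ifs with h
    · refine ⟨?_, fun _ => ?_, ?_⟩
      · rw [h1, pow_succ]; ring
      · dsimp only; nlinarith
      · dsimp only; omega
    · exact ⟨h1, h2, .inl (not_le.1 h)⟩

theorem blockParams_snd (n : ℕ) : (blockParams n).2 = 2 ^ (blockParams n).1 :=
  (blockStep_iterate n n).1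

theorem blockParams_sq_le {n : ℕ} (hn : 1 ≤ n) :
    (blockParams n).2 * (blockParams n).2 ≤ 4 * n := (blockStep_iterate n n).2.1 hn

theorem lt_blockParams_sq (n : ℕ) : n < (blockParams n).2 * (blockParams n).2 := by
  rcases (blockStep_iterate n n).2.2 with h | h
  · exact h
  · change (blockParams n).1 = n at h
    rw [blockParams_snd, h]
    have := Nat.lt_two_pow_self (n := n)
    nlinarith

theorem blockParams_fst_pos {n : ℕ} (hn : 1 ≤ n) : 1 ≤ (blockParams n).1 := by
  by_contra h
  have h0 : (blockParams n).1 = 0 := by omega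
  have := lt_blockParams_sq n
  rw [blockParams_snd, h0] at this
  omega

theorem blockParams_snd_pos (n : ℕ) : 1 ≤ (blockParams n).2 := by
  rw [blockParams_snd]; exact Nat.one_le_two_pow

/-- The tests of a literal: is its block wire in the coalition of an anchor `4 + j`, for the
assignments `j` to the block that satisfy the literal? -/
def literalTests (B : ℕ × ℕ) (l : ℕ × Bool) : List WireOp :=
  (List.range B.2).flatMap fun j =>
    if j.testBit (l.1 % B.1) = l.2 then [(true, 4 + B.2 + l.1 / B.1, 4 + j)] else []

/-- The tests of the literals of a clause; after them one of them is enforced to have succeeded. -/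
def clauseOps (B : ℕ × ℕ) (c : List (ℕ × Bool)) : List WireOp :=
  (false, 0, 3) :: c.flatMap (literalTests B)

/-- The base wire and the anchors are pairwise in different coalitions. -/
def distinctOps (q : ℕ) : List WireOp :=
  (List.range (q + 1)).flatMap fun i => (List.range i).map fun j => (false, 3 + i, 3 + j)

/-- The operations of a formula with `n` variables. -/
def formulaOps (n : ℕ) (cls : List (List (ℕ × Bool))) : List WireOp :=
  cls.flatMap (clauseOps (blockParams n)) ++ distinctOps (blockParams n).2

/-- The number of vertices in a time slice: the flag, the gadget and its guard, the base wire, the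
`q` anchors, and a wire for each block of variables. -/
def formulaWidth (n : ℕ) : ℕ := 4 + (blockParams n).2 + (n / (blockParams n).1 + 1)

theorem mem_literalTests {B : ℕ × ℕ} {l : ℕ × Bool} {o : WireOp} :
    o ∈ literalTests B l ↔
      ∃ j < B.2, j.testBit (l.1 % B.1) = l.2 ∧ o = (true, 4 + B.2 + l.1 / B.1, 4 + j) := by
  simp only [literalTests, List.mem_flatMap, List.mem_range]
  refine exists_congr fun j => and_congr_right fun _ => ?_
  split_ifs with h <;> simp [h]

theorem mem_distinctOps {q : ℕ} {o : WireOp} :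
    o ∈ distinctOps q ↔ ∃ i ≤ q, ∃ j < i, o = (false, 3 + i, 3 + j) := by
  simp [distinctOps, eq_comm]

theorem wellFormed_formula {n : ℕ} {cls : List (List (ℕ × Bool))}
    (hcls : ∀ c ∈ cls, ∀ l ∈ c, l.1 < n) : WellFormed (formulaOps n cls) (formulaWidth n) := by
  obtain ⟨g, hg⟩ : ∃ g, n / (blockParams n).1 = g := ⟨_, rfl⟩
  refine ⟨by rw [formulaWidth, hg]; omega, fun o ho => ?_⟩
  rw [formulaOps, List.mem_append, List.mem_flatMap] at ho
  rcases ho with ⟨c, hc, ho⟩ | ho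
  · rw [clauseOps, List.mem_cons, List.mem_flatMap] at ho
    rcases ho with rfl | ⟨l, hl, ho⟩
    · simp [formulaWidth, hg]; omega
    · obtain ⟨j, hj, -, rfl⟩ := mem_literalTests.1 ho
      have : l.1 / (blockParams n).1 ≤ n / (blockParams n).1 :=
        Nat.div_le_div_right (hcls c hc l hl).le
      rw [hg] at this
      generalize l.1 / (blockParams n).1 = i at *
      simp [formulaWidth, hg]; omega
  · obtain ⟨i, hi, j, hj, rfl⟩ := mem_distinctOps.1 ho
    simp [formulaWidth, hg]; omega

/-- After the operations of some clauses the flag has just been reset. -/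
theorem exists_enforce_cons (B : ℕ × ℕ) (hq : 1 ≤ B.2) (cls : List (List (ℕ × Bool))) :
    ∃ α β p, cls.flatMap (clauseOps B) ++ distinctOps B.2 = (false, α, β) :: p := by
  rcases cls with _ | ⟨c, cls⟩
  · cases h : distinctOps B.2 with
    | nil =>
      have : (false, 3 + 1, 3 + 0) ∈ distinctOps B.2 :=
        mem_distinctOps.2 ⟨1, hq, 0, by omega, rfl⟩
      simp [h] at this
    | cons o p =>
      obtain ⟨i, -, j, -, rfl⟩ := mem_distinctOps.1 (h ▸ List.mem_cons_self : o ∈ distinctOps B.2)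
      exact ⟨_, _, _, rfl⟩
  · exact ⟨_, _, _, rfl⟩

/-- A formula is satisfiable if its game has a stable colouring: a block wire in the coalition of
an anchor tells the assignment to the block. -/
theorem exists_assignment_of_isStableColoring {n : ℕ} {cls : List (List (ℕ × Bool))}
    (hcls : ∀ c ∈ cls, ∀ l ∈ c, l.1 < n) {c : WireVertex → ℕ}
    (hc : IsStableColoring (wireVerts (formulaOps n cls) (formulaWidth n)) wireArcs c) :
    ∃ a : ℕ → Bool, ∀ cl ∈ cls, ∃ l ∈ cl, a l.1 = l.2 := by
  have hw := wellFormed_formula hcls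
  set B := blockParams n with hB
  have hS : 4 + B.2 < formulaWidth n := Nat.lt_add_of_pos_right (Nat.succ_pos _)
  have hdist : ∀ i ≤ B.2, ∀ j < i, c ([], 3 + i) ≠ c ([], 3 + j) := by
    intro i hi j hj
    have hmem : (false, 3 + i, 3 + j) ∈ formulaOps n cls :=
      List.mem_append_right _ (mem_distinctOps.2 ⟨i, hi, j, hj, rfl⟩)
    obtain ⟨s, t, hst⟩ := List.append_of_mem hmem
    have hsuf : (false, 3 + i, 3 + j) :: t <:+ formulaOps n cls := ⟨s, hst.symm⟩
    have ht := (List.suffix_cons _ t).trans hsuf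
    have := hc.ne_of_enforce hw.1 hsuf
    rwa [hc.wire_const ht (by omega) (by omega), hc.wire_const ht (by omega) (by omega)] at this
  have hinj : ∀ j < B.2, ∀ j' < B.2, c ([], 4 + j) = c ([], 4 + j') → j = j' := by
    intro j hj j' hj' he
    rcases lt_trichotomy j j' with h | h | h
    · have := hdist (j' + 1) hj' (j + 1) (by omega)
      rw [show 3 + (j' + 1) = 4 + j' by omega, show 3 + (j + 1) = 4 + j by omega] at this
      exact absurd he.symm this
    · exact h
    · have := hdist (j + 1) hj (j' + 1) (by omega)
      rw [show 3 + (j' + 1) = 4 + j' by omega, show 3 + (j + 1) = 4 + j by omega] at this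
      exact absurd he this
  have hbase : ∀ j < B.2, c ([], 4 + j) ≠ c ([], 3) := by
    intro j hj
    have := hdist (j + 1) hj 0 (by omega)
    rwa [show 3 + (j + 1) = 4 + j by omega] at this
  classical
  refine ⟨fun v => decide (∃ j < B.2, c ([], 4 + B.2 + v / B.1) = c ([], 4 + j) ∧
    j.testBit (v % B.1) = true), fun cl hcl => ?_⟩
  obtain ⟨cls₁, cls₂, rfl⟩ := List.append_of_mem hcl
  set rest := cls₂.flatMap (clauseOps B) ++ distinctOps B.2 with hrest
  have hsuf : (false, 0, 3) :: (cl.flatMap (literalTests B) ++ rest) <:+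
      formulaOps n (cls₁ ++ cl :: cls₂) :=
    ⟨cls₁.flatMap (clauseOps B), by simp [formulaOps, clauseOps, hrest, hB]⟩
  have hsuf' := (List.suffix_cons _ _).trans hsuf
  have hflag := hc.ne_of_enforce hw.1 hsuf
  rw [hc.wire_const hsuf' le_rfl hw.1] at hflag
  obtain ⟨α, β, p, hp⟩ := exists_enforce_cons B (blockParams_snd_pos n) cls₂
  have hreset : c (rest, 0) = c ([], 3) := by
    have := (List.suffix_append _ _).trans hsuf'
    rw [hrest, hp] at this ⊢
    exact hc.flag_reset hw.1 this
  -- one of the tests succeeds, since otherwise the flag would stay with the base wire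
  obtain ⟨o, ho, heq⟩ : ∃ o ∈ cl.flatMap (literalTests B), c ([], o.2.1) = c ([], o.2.2) := by
    by_contra! hne
    refine hflag (hc.flag_tests hw hsuf' hreset fun o ho => ?_)
    have h := hne o ho
    obtain ⟨l, -, hl⟩ := List.mem_flatMap.1 ho
    obtain ⟨j, hj, -, rfl⟩ := mem_literalTests.1 hl
    exact ⟨rfl, hbase j hj, h⟩
  obtain ⟨l, hl, hlo⟩ := List.mem_flatMap.1 ho
  obtain ⟨j, hj, hbit, rfl⟩ := mem_literalTests.1 hlo
  refine ⟨l, hl, ?_⟩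
  dsimp only at heq
  cases hl2 : l.2 with
  | true => exact decide_eq_true ⟨j, hj, heq, hbit.trans hl2⟩
  | false =>
    refine decide_eq_false ?_
    rintro ⟨j', hj', heq', hbit'⟩
    obtain rfl := hinj j hj j' hj' (heq.symm.trans heq')
    rw [hbit, hl2] at hbit'
    cases hbit'

/-- An enforcement in a list that begins with tests comes after these tests. -/
theorem suffix_of_suffix_tests {tests rest p : List WireOp} {o : WireOp}
    (ht : ∀ o ∈ tests, o.1 = true) (ho : o.1 = false) (h : o :: p <:+ tests ++ rest) :
    o :: p <:+ rest := by
  induction tests with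
  | nil => exact h
  | cons t tests ih =>
    rw [List.cons_append, List.suffix_cons_iff] at h
    rcases h with h | h
    · obtain ⟨rfl, -⟩ := List.cons.inj h
      have := ht o List.mem_cons_self
      rw [ho] at this
      cases this
    · exact ih (fun o ho => ht o (List.mem_cons_of_mem _ ho)) h

/-- A satisfying assignment gives a stable colouring, in which each block wire has the colour of the
anchor of the assignment to its block. -/
theorem exists_isStableColoring_of_assignment {n : ℕ} {cls : List (List (ℕ × Bool))}
    (hcls : ∀ c ∈ cls, ∀ l ∈ c, l.1 < n) {a : ℕ → Bool}
    (ha : ∀ cl ∈ cls, ∃ l ∈ cl, a l.1 = l.2) :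
    ∃ c, IsStableColoring (wireVerts (formulaOps n cls) (formulaWidth n)) wireArcs c := by
  have hw := wellFormed_formula hcls
  set B := blockParams n with hB
  have hBq : B.2 = 2 ^ B.1 := blockParams_snd n
  set val : ℕ → ℕ := fun i => Nat.ofBits fun r : Fin B.1 => a (i * B.1 + r) with hval
  have hlt : ∀ i, val i < B.2 := fun i => hBq ▸ Nat.ofBits_lt_two_pow _
  set A : ℕ → ℕ := fun r => if r < 4 + B.2 then r else 4 + val (r - 4 - B.2) with hA
  have hA1 : ∀ r < 4 + B.2, A r = r := fun r hr => if_pos hr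
  have hA3 : A 3 = 3 := hA1 3 (by omega)
  have hA2 : ∀ i, A (4 + B.2 + i) = 4 + val i := fun i => by
    simp only [hA]
    rw [if_neg (by omega)]
    congr 2; omega
  have hbit : ∀ v < n, (val (v / B.1)).testBit (v % B.1) = a v := by
    intro v hv
    have hpos : 1 ≤ B.1 := blockParams_fst_pos (by omega)
    rw [hval]
    dsimp only
    rw [Nat.testBit_ofBits_lt _ _ (Nat.mod_lt _ hpos)]
    dsimp only
    rw [Nat.div_add_mod']
  refine ⟨circuitColor A, isStableColoring_circuitColor hw ?_ ?_⟩
  · intro o ho hot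
    rw [formulaOps, List.mem_append, List.mem_flatMap] at ho
    rcases ho with ⟨c, hc, ho⟩ | ho
    · rw [clauseOps, List.mem_cons, List.mem_flatMap] at ho
      rcases ho with rfl | ⟨l, hl, ho⟩
      · cases hot
      · obtain ⟨j, hj, -, rfl⟩ := mem_literalTests.1 ho
        rw [hA3, hA1 _ (by simpa using hj)]
        dsimp only; omega
    · obtain ⟨i, hi, j, hj, rfl⟩ := mem_distinctOps.1 ho
      cases hot
  · intro α β p hp
    rw [formulaOps, ← hB] at hp
    clear hw
    induction cls with
    | nil =>
      obtain ⟨i, hi, j, hj, he⟩ := mem_distinctOps.1 (hp.subset List.mem_cons_self)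
      simp only [Prod.mk.injEq] at he
      obtain ⟨-, rfl, rfl⟩ := he
      refine ⟨by omega, .inr ⟨by omega, ?_⟩⟩
      rw [hA1 _ (by omega), hA1 _ (by omega)]
      omega
    | cons cl cls ih =>
      have htests : ∀ o ∈ cl.flatMap (literalTests B), o.1 = true ∧ A o.2.2 ≠ A 3 := by
        intro o ho
        obtain ⟨l, -, hl⟩ := List.mem_flatMap.1 ho
        obtain ⟨j, hj, -, rfl⟩ := mem_literalTests.1 hl
        refine ⟨rfl, ?_⟩
        rw [hA3, hA1 _ (by simpa using hj)]
        dsimp only; omega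
      rw [List.flatMap_cons, clauseOps, List.cons_append, List.cons_append,
        List.suffix_cons_iff, List.append_assoc] at hp
      rcases hp with hp | hp
      · simp only [List.cons.injEq, Prod.mk.injEq, true_and] at hp
        obtain ⟨⟨rfl, rfl⟩, rfl⟩ := hp
        refine ⟨le_rfl, .inl ⟨rfl, ?_⟩⟩
        obtain ⟨l, hl, hal⟩ := ha cl List.mem_cons_self
        have hln := hcls cl List.mem_cons_self l hl
        refine flagColor_append_ne (fun o ho => (htests o ho).1)
          (List.mem_flatMap.2 ⟨l, hl, mem_literalTests.2 ⟨val (l.1 / B.1), hlt _,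
            (hbit _ hln).trans hal, rfl⟩⟩) ?_ ?_ fun o ho => (htests o ho).2
        · rw [hA2, hA1 _ (by simpa using hlt _)]
        · rw [hA2, hA3]
          omega
      · exact ih (fun c hc => hcls c (List.mem_cons_of_mem _ hc))
          (fun c hc => ha c (List.mem_cons_of_mem _ hc))
          (suffix_of_suffix_tests (fun o ho => (htests o ho).1) rfl hp)

/-- The bound `2 * formulaWidth n` on the pathwidth is `O(n / log n)`: its product with its own
binary logarithm, rounded up to `e`, is linear in `n`. -/
theorem formulaWidth_bounds {n : ℕ} (hn : 1 ≤ n) :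
    ∃ e : ℕ, 2 * formulaWidth n ≤ 2 ^ e ∧ 2 * formulaWidth n * e ≤ 300 * n := by
  have h1 := blockParams_snd n
  have h2 := blockParams_sq_le hn
  have h3 := lt_blockParams_sq n
  have h4 := blockParams_fst_pos hn
  have h5 : (blockParams n).1 < (blockParams n).2 := h1 ▸ Nat.lt_two_pow_self
  have h6 := Nat.div_mul_le_self n (blockParams n).1
  have h7 := Nat.div_le_self n (blockParams n).1
  unfold formulaWidth
  generalize (blockParams n).1 = l at *
  generalize (blockParams n).2 = q at *
  generalize n / l = g at *
  -- `n < 4 ^ l`, so the width is at most a constant times `4 ^ l`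
  refine ⟨2 * l + 4, ?_, ?_⟩
  · rw [pow_add, two_mul l, pow_add, ← h1]
    nlinarith
  · nlinarith

/-! ### The reduction is computable in polynomial time -/

theorem polyTime_blockStep : PolyTime fun p : ℕ × ℕ × ℕ => blockStep p.1 p.2 :=
  .ite (.natLe (.mul (by fun_prop) (by fun_prop)) (by fun_prop)) (by fun_prop) (by fun_prop)

theorem polyTime_blockParams : PolyTime blockParams :=
  PolyTime.iterate (n := fun n => n) (init := fun _ => (0, 1)) (step := blockStep)
    (by fun_prop) (by fun_prop) polyTime_blockStep (B := fun n => n + 1)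
    ((PolyBounded.codeSize.mono fun n => (codeSize_nat n).ge).add (.const 1))
    (fun n x => by
      obtain ⟨l, q⟩ := x
      rw [blockStep]
      split_ifs with h
      · dsimp only at h
        simp only [codeSize_prod, codeSize_nat]
        nlinarith
      · omega)

theorem polyTime_literalTests : PolyTime fun p : (ℕ × ℕ) × ℕ × Bool => literalTests p.1 p.2 := by
  refine .flatMap (by fun_prop) (.ite (.boolEq (.testBit (by fun_prop) ?_) (by fun_prop))
    (.cons (.prodMk (by fun_prop) (.prodMk (.add (by fun_prop) ?_) (by fun_prop))) (by fun_prop))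
    (by fun_prop))
  · exact (PolyTime.divMod (f := fun p : ((ℕ × ℕ) × ℕ × Bool) × ℕ => p.1.2.1)
      (g := fun p => p.1.1.1) (by fun_prop) (by fun_prop)).snd
  · exact (PolyTime.divMod (f := fun p : ((ℕ × ℕ) × ℕ × Bool) × ℕ => p.1.2.1)
      (g := fun p => p.1.1.1) (by fun_prop) (by fun_prop)).fst

theorem polyTime_clauseOps : PolyTime fun p : (ℕ × ℕ) × List (ℕ × Bool) => clauseOps p.1 p.2 :=
  .cons (by fun_prop) (.flatMap (f := fun (p : (ℕ × ℕ) × List (ℕ × Bool)) l => literalTests p.1 l)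
    (by fun_prop) (polyTime_literalTests.comp
      (f := fun p : ((ℕ × ℕ) × List (ℕ × Bool)) × ℕ × Bool => (p.1.1, p.2)) (by fun_prop)))

theorem polyTime_distinctOps : PolyTime distinctOps :=
  .flatMap (f := fun _ i => (List.range i).map fun j => (false, 3 + i, 3 + j)) (by fun_prop)
    (.map (f := fun (p : ℕ × ℕ) j => (false, 3 + p.2, 3 + j)) (by fun_prop) (by fun_prop))

theorem polyTime_formulaOps :
    PolyTime fun x : ℕ × List (List (ℕ × Bool)) => formulaOps x.1 x.2 :=
  .append (.flatMap (f := fun (x : ℕ × List (List (ℕ × Bool))) c => clauseOps (blockParams x.1) c)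
    (by fun_prop) (polyTime_clauseOps.comp
      (f := fun p : (ℕ × List (List (ℕ × Bool))) × List (ℕ × Bool) => (blockParams p.1.1, p.2))
      (.prodMk (polyTime_blockParams.comp (by fun_prop)) (by fun_prop))))
    (polyTime_distinctOps.comp (.snd (polyTime_blockParams.comp (by fun_prop))))

theorem polyTime_formulaWidth : PolyTime formulaWidth :=
  .add (.add (by fun_prop) polyTime_blockParams.snd)
    (.succ (PolyTime.divMod (f := fun n => n) (by fun_prop) polyTime_blockParams.fst).fst)

theorem polyTime_wireVerts : PolyTime fun p : List WireOp × ℕ => wireVerts p.1 p.2 :=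
  .flatMap (f := fun (p : List WireOp × ℕ) s => (List.range p.2).map fun r => (s, r)) (by fun_prop)
    (.map (f := fun (p : (List WireOp × ℕ) × List WireOp) r => (p.2, r)) (by fun_prop)
      (by fun_prop))

theorem polyTime_wireArcs : PolyTime wireArcs := by
  have : PolyTime fun v : WireVertex => bif v.1.isEmpty then [] else
      if v.2 = 0 then
        if (v.1.headD (false, 0, 0)).1 = true then
          [((v.1.tail, 0), 1), ((v.1.tail, 3), -1), ((v.1, 1), 1)]
        else [((v.1.tail, 3), (1 : ℤ))]
      else if v.2 = 1 then
        if (v.1.headD (false, 0, 0)).1 = true then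
          [((v.1.tail, (v.1.headD (false, 0, 0)).2.1), 2),
            ((v.1.tail, (v.1.headD (false, 0, 0)).2.2), 2), ((v.1.tail, 3), 3)]
        else [((v.1.tail, (v.1.headD (false, 0, 0)).2.1), 1),
          ((v.1.tail, (v.1.headD (false, 0, 0)).2.2), -1), ((v.1, 2), -1)]
      else if v.2 = 2 then [((v.1, 1), 1)]
      else [((v.1.tail, v.2), 1)] := by
    refine .cond (by fun_prop) (by fun_prop) (.ite (by fun_prop) (.ite ?_ ?_ ?_)
      (.ite (by fun_prop) (.ite ?_ ?_ ?_) (.ite (by fun_prop) ?_ ?_)))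
    all_goals fun_prop
  refine this.congr fun v => ?_
  obtain ⟨s, r⟩ := v
  cases s <;> rfl

/-- The vertices of the game of a formula. -/
def formulaVerts (x : ℕ × List (List (ℕ × Bool))) : List WireVertex :=
  wireVerts (formulaOps x.1 x.2) (formulaWidth x.1)

theorem polyTime_formulaVerts : PolyTime formulaVerts :=
  polyTime_wireVerts.comp (f := fun x : ℕ × List (List (ℕ × Bool)) =>
    (formulaOps x.1 x.2, formulaWidth x.1))
    (.prodMk polyTime_formulaOps (polyTime_formulaWidth.comp (by fun_prop)))

/-- An entry of the adjacency matrix of a circuit. Time slices are compared by their lengths. -/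
def wireEntry (u v : WireVertex) : Option ℤ :=
  ((wireArcs u).find? fun p => decide (p.1.1.length = v.1.length) && decide (p.1.2 = v.2)).map
    Prod.snd

theorem polyTime_wireEntry : PolyTime fun p : WireVertex × WireVertex => wireEntry p.1 p.2 :=
  .lookup (f := fun p : WireVertex × WireVertex => wireArcs p.1)
    (c := fun p (w : WireVertex) => decide (w.1.length = p.2.1.length) && decide (w.2 = p.2.2))
    (polyTime_wireArcs.comp (by fun_prop))
    (.and (.natEq (by fun_prop) (by fun_prop)) (.natEq (by fun_prop) (by fun_prop)))

/-- The adjacency matrix of the game of a formula. -/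
def formulaMatrix (x : ℕ × List (List (ℕ × Bool))) : List (List (Option ℤ)) :=
  (formulaVerts x).map fun u => (formulaVerts x).map fun v => wireEntry u v

theorem polyTime_formulaMatrix : PolyTime formulaMatrix := by
  have h : PolyTime fun y : (ℕ × List (List (ℕ × Bool))) × WireVertex =>
      (formulaVerts y.1).map fun v => wireEntry y.2 v :=
    .map (f := fun (y : (ℕ × List (List (ℕ × Bool))) × WireVertex) v => wireEntry y.2 v)
      (polyTime_formulaVerts.comp (by fun_prop)) (polyTime_wireEntry.comp
        (f := fun p : ((ℕ × List (List (ℕ × Bool))) × WireVertex) × WireVertex => (p.1.2, p.2))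
        (by fun_prop))
  exact .map (f := fun x u => (formulaVerts x).map fun v => wireEntry u v) polyTime_formulaVerts h

theorem code_formulaMatrix {n : ℕ} {cls : List (List (ℕ × Bool))}
    (h : ∀ c ∈ cls, ∀ l ∈ c, l.1 < n) :
    code (formulaMatrix (n, cls)) = (isArcGame_wire (wellFormed_formula h)).game.encode := by
  rw [← IsArcGame.code_matrix, formulaMatrix, formulaVerts]
  congr 1
  refine List.map_congr_left fun u hu => List.map_congr_left fun v hv => ?_
  rw [arcWeight, wireEntry]
  congr 1
  refine List.find?_congr fun p hp => ?_
  have hp := mem_wireVerts.1 ((isArcGame_wire (wellFormed_formula h)).mem_verts u hu p hp)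
  rw [mem_wireVerts] at hv
  rw [← Bool.decide_and]
  refine decide_eq_decide.2 ⟨fun hh => ?_, fun hh => by rw [hh]; exact ⟨rfl, rfl⟩⟩
  exact Prod.ext (eq_of_suffix_of_length_eq hp.1 hv.1 hh.1) hh.2

/-- A polynomial-time reduction may be followed by any program. -/
theorem PolyTime.exists_prog {α β : Type*} [DataCode α] [DataCode β] {g : α → β}
    (hg : PolyTime g) : ∃ (R : Prog) (j : ℕ), (∀ a, codeSize (g a) ≤ (codeSize a + 2) ^ j) ∧
      ∀ a (M : Prog) (A : Prop) (T : ℝ), M.AnswersWithin (code (g a)) A T →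
        (R.seq M).AnswersWithin (code a) A (((codeSize a + 2) ^ j : ℕ) + T) := by
  obtain ⟨hgs, T, hT, hR⟩ := hg
  obtain ⟨R, hR⟩ := hR 0
  obtain ⟨K, hK⟩ := R.exists_unchanged
  obtain ⟨j, hj⟩ := hgs.add (hT.add (.const (K + 1)))
  refine ⟨.seq R (.clearUpTo K), j, fun a => le_of_add_le_left (hj a), fun a M A T' hM => ?_⟩
  obtain ⟨t, s, hr, ht, hs⟩ := hR (Prog.initStore (code a)) a (by simp [Prog.initStore])
  obtain ⟨t', s', hr', ht', rfl⟩ := Prog.reaches_clearUpTo K s fun i hi => by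
    rw [hK _ _ _ hr i hi.le]
    simp [Prog.initStore, show i ≠ 0 by omega]
  rw [hs.1] at hr'
  obtain ⟨t'', s'', hr'', ht'', hA⟩ := hM
  refine ⟨_, s'', (hr.seq hr').seq hr'', ?_, hA⟩
  have h1 : t + t' ≤ (codeSize a + 2) ^ j := le_trans (by dsimp only; omega) (hj a)
  have h2 : ((t + t' : ℕ) : ℝ) ≤ ((codeSize a + 2) ^ j : ℕ) := by exact_mod_cast h1
  push_cast at h2 ⊢
  linarith

/-! ### The lower bound -/

/-- The clauses of a formula as lists of pairs of the number and the sign of a variable. -/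
def clauseLists {n : ℕ} (φ : ThreeCNF n) : List (List (ℕ × Bool)) :=
  φ.map fun c => [((c.1.1 : ℕ), c.1.2), ((c.2.1.1 : ℕ), c.2.1.2), ((c.2.2.1 : ℕ), c.2.2.2)]

theorem clauseLists_lt {n : ℕ} (φ : ThreeCNF n) : ∀ c ∈ clauseLists φ, ∀ l ∈ c, l.1 < n := by
  intro c hc l hl
  obtain ⟨⟨l₁, l₂, l₃⟩, -, rfl⟩ := List.mem_map.1 hc
  simp only [List.mem_cons, List.not_mem_nil, or_false] at hl
  rcases hl with rfl | rfl | rfl <;> exact Fin.is_lt _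

theorem code_clauseLists {n : ℕ} (φ : ThreeCNF n) : code (n, clauseLists φ) = φ.encode := by
  simp only [code, clauseLists, ThreeCNF.encode, List.map_map]
  rfl

theorem codeSize_clauseLists_le {n : ℕ} (φ : ThreeCNF n) :
    codeSize (n, clauseLists φ) + 2 ≤ 16 * (n + φ.length + 1) ^ 2 := by
  have h : codeSize (clauseLists φ) ≤ φ.length * (3 * n + 10) := by
    induction φ with
    | nil => simp [clauseLists]
    | cons c φ ih =>
      have h1 := codeSize_bool c.1.2
      have h2 := codeSize_bool c.2.1.2
      have h3 := codeSize_bool c.2.2.2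
      have h4 := c.1.1.is_lt
      have h5 := c.2.1.1.is_lt
      have h6 := c.2.2.1.is_lt
      rw [clauseLists] at ih ⊢
      simp only [List.map_cons, codeSize_cons, codeSize_prod, codeSize_nat, codeSize_nil,
        List.length_cons, add_mul] at ih ⊢
      omega
  rw [codeSize_prod, codeSize_nat]
  nlinarith

theorem exists_assignment_iff {n : ℕ} (φ : ThreeCNF n) :
    (∃ a : ℕ → Bool, ∀ cl ∈ clauseLists φ, ∃ l ∈ cl, a l.1 = l.2) ↔ φ.Satisfiable := by
  simp only [clauseLists, List.forall_mem_map, List.exists_mem_cons_iff, List.not_mem_nil,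
    false_and, exists_false, or_false]
  constructor
  · rintro ⟨a, ha⟩
    exact ⟨fun v => a v, ha⟩
  · rintro ⟨a, ha⟩
    refine ⟨fun v => if h : v < n then a ⟨v, h⟩ else false, fun c hc => ?_⟩
    simpa using ha c hc

/-- The exponent of the running time, as a function of the number of variables: since the width is
`O(n / log n)`, a factor `p ^ o(p)` is `2 ^ o(n)`. -/
theorem exists_isLittleO_exponent {f : ℕ → ℝ} (hf : f =o[atTop] fun p : ℕ => (p : ℝ)) :
    ∃ h : ℕ → ℝ, h =o[atTop] (fun n : ℕ => (n : ℝ)) ∧ (∀ n, 0 ≤ h n) ∧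
      ∀ n p, p ≤ 2 * formulaWidth n → ((max p 2 : ℕ) : ℝ) ^ f p ≤ 2 ^ h n := by
  set F : ℕ → ℝ := fun p => |f p| * Real.logb 2 (max p 2 : ℕ) with hF
  have hlog : ∀ p : ℕ, 0 ≤ Real.logb 2 (max p 2 : ℕ) := fun p =>
    Real.logb_nonneg (by norm_num) (by exact_mod_cast (by omega : 1 ≤ max p 2))
  have hF0 : ∀ p, 0 ≤ F p := fun p => mul_nonneg (abs_nonneg _) (hlog p)
  have hne : ∀ n, (Finset.range (2 * formulaWidth n + 1)).Nonempty := fun n => ⟨0, by simp⟩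
  refine ⟨fun n => (Finset.range (2 * formulaWidth n + 1)).sup' (hne n) F, ?_, fun n => ?_,
    fun n p hp => ?_⟩
  · rw [isLittleO_iff]
    intro ε hε
    obtain ⟨p₀, hp₀⟩ := eventually_atTop.1 (isLittleO_iff.1 hf (by positivity : 0 < ε / 300))
    obtain ⟨n₀, hn₀⟩ := exists_nat_ge ((∑ p ∈ Finset.range p₀, F p) / ε)
    filter_upwards [eventually_ge_atTop (max 1 n₀)] with n hn
    have h0 : 0 ≤ (Finset.range (2 * formulaWidth n + 1)).sup' (hne n) F :=
      (hF0 0).trans (Finset.le_sup' F (by simp))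
    rw [Real.norm_of_nonneg h0, Real.norm_of_nonneg (Nat.cast_nonneg n)]
    refine Finset.sup'_le _ _ fun p hp => ?_
    have hp : p ≤ 2 * formulaWidth n := by simpa [Nat.lt_succ_iff] using hp
    by_cases hpp : p < p₀
    · have h1 : F p ≤ ∑ p ∈ Finset.range p₀, F p :=
        Finset.single_le_sum (fun i _ => hF0 i) (Finset.mem_range.2 hpp)
      have h2 : (n₀ : ℝ) ≤ n := by exact_mod_cast (le_max_right 1 n₀).trans hn
      rw [div_le_iff₀ hε] at hn₀
      nlinarith
    · obtain ⟨e, he, hle⟩ := formulaWidth_bounds ((le_max_left 1 n₀).trans hn)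
      have h1 := hp₀ p (not_lt.1 hpp)
      rw [Real.norm_eq_abs, Real.norm_of_nonneg (Nat.cast_nonneg p)] at h1
      have h2 : Real.logb 2 (max p 2 : ℕ) ≤ e := by
        rw [Real.logb_le_iff_le_rpow (by norm_num) (by positivity), Real.rpow_natCast]
        have : max p 2 ≤ 2 ^ e := by
          refine le_trans (max_le hp ?_) he
          rw [formulaWidth]; generalize n / _ = g; omega
        exact_mod_cast this
      have h3 : (p : ℝ) ≤ (2 * formulaWidth n : ℕ) := by exact_mod_cast hp
      have h4 : ((2 * formulaWidth n : ℕ) : ℝ) * e ≤ 300 * n := by exact_mod_cast hle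
      calc F p ≤ (ε / 300 * (2 * formulaWidth n : ℕ)) * e :=
            mul_le_mul (h1.trans (by gcongr)) h2 (hlog p) (by positivity)
        _ = ε / 300 * ((2 * formulaWidth n : ℕ) * e) := by ring
        _ ≤ ε / 300 * (300 * n) := by gcongr
        _ = ε * n := by ring
  · exact (hF0 0).trans (Finset.le_sup' F (by simp))
  · have h2 : ((max p 2 : ℕ) : ℝ) = (2 : ℝ) ^ Real.logb 2 (max p 2 : ℕ) :=
      (Real.rpow_logb (by norm_num) (by norm_num) (by positivity)).symm
    rw [h2, ← Real.rpow_mul (by norm_num)]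
    refine Real.rpow_le_rpow_of_exponent_le (by norm_num) ?_
    calc Real.logb 2 (max p 2 : ℕ) * f p ≤ Real.logb 2 (max p 2 : ℕ) * |f p| :=
          mul_le_mul_of_nonneg_left (le_abs_self _) (hlog p)
      _ = F p := mul_comm _ _
      _ ≤ _ := Finset.le_sup' F (by simpa [Nat.lt_succ_iff] using hp)

/-- Under the ETH there are constants `Δ` and `W` such that no algorithm decides Nash stability of
games with maximum degree at most `Δ` and absolute weights at most `W` in time
`p ^ o(p) * n ^ O(1)`, where `p` is the pathwidth and `n` the number of vertices. The base
`max p 2` differs from `p` only for `p ≤ 1`, where it allows an arbitrary constant factor. -/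
theorem mainTheorem3 (hETH : ETH) :
    ∃ Δ W : ℕ, ¬ ∃ (M : Prog) (f : ℕ → ℝ) (k : ℕ), f =o[atTop] (fun p : ℕ => (p : ℝ)) ∧
      NashStabilityDecidedInTime Δ W M
        fun n p => ((max p 2 : ℕ) : ℝ) ^ f p * ((n + 1 : ℕ) : ℝ) ^ k := by
  refine ⟨12, 3, ?_⟩
  rintro ⟨M, f, k, hf, hM⟩
  obtain ⟨h, hh, hh0, hexp⟩ := exists_isLittleO_exponent hf
  obtain ⟨R, j, hsize, hR⟩ := polyTime_formulaMatrix.exists_prog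
  set E := j + (j + 1) * k + 1 with hE
  refine hETH ⟨R.seq M, fun n => h n + (4 * E : ℕ), 2 * E, hh.add ?_, fun n φ => ?_⟩
  · exact isLittleO_const_left.2 (.inr (tendsto_norm_atTop_atTop.comp tendsto_natCast_atTop_atTop))
  have hlt := clauseLists_lt φ
  set G := (isArcGame_wire (wellFormed_formula hlt)).game with hG
  have hsat : G.HasNashStablePartition ↔ φ.Satisfiable := by
    rw [hG, IsArcGame.hasNashStablePartition_iff, ← exists_assignment_iff]
    exact ⟨fun ⟨c, hc⟩ => exists_assignment_of_isStableColoring hlt hc,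
      fun ⟨a, ha⟩ => exists_isStableColoring_of_assignment hlt ha⟩
  have hMG := hM _ G (maxDegreeLE_wire (wellFormed_formula hlt))
    (absWeightLE_wire (wellFormed_formula hlt))
  rw [hsat, hG, ← code_formulaMatrix hlt] at hMG
  have hRM := hR (n, clauseLists φ) M _ _ hMG
  rw [code_clauseLists] at hRM
  obtain ⟨t, s, hr, ht, hA⟩ := hRM
  refine ⟨t, s, hr, ht.trans ?_, hA⟩
  -- all polynomial factors are at most powers of `X`
  set X := 16 * (n + φ.length + 1) ^ 2 with hX
  have hX2 : 2 ≤ X := by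
    have : 1 ≤ (n + φ.length + 1) ^ 2 := Nat.one_le_pow _ _ (Nat.succ_pos _)
    omega
  have hcode := codeSize_clauseLists_le φ
  have hverts : (wireVerts (formulaOps n (clauseLists φ)) (formulaWidth n)).length + 1 ≤
      X ^ (j + 1) := by
    have h1 := (length_le_codeSize _).trans (hsize (n, clauseLists φ))
    rw [formulaMatrix, List.length_map, formulaVerts] at h1
    have h2 : (codeSize (n, clauseLists φ) + 2) ^ j ≤ X ^ j := Nat.pow_le_pow_left hcode j
    have h3 : 1 ≤ X ^ j := Nat.one_le_pow _ _ (by omega)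
    rw [pow_succ]
    nlinarith
  have hpoly : (codeSize (n, clauseLists φ) + 2) ^ j +
      ((wireVerts (formulaOps n (clauseLists φ)) (formulaWidth n)).length + 1) ^ k ≤ X ^ E := by
    have h1 : (codeSize (n, clauseLists φ) + 2) ^ j ≤ X ^ (j + (j + 1) * k) :=
      (Nat.pow_le_pow_left hcode j).trans (Nat.pow_le_pow_right (by omega) (by omega))
    have h2 : ((wireVerts (formulaOps n (clauseLists φ)) (formulaWidth n)).length + 1) ^ k ≤
        X ^ (j + (j + 1) * k) := by
      refine (Nat.pow_le_pow_left hverts k).trans ?_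
      rw [← pow_mul]
      exact Nat.pow_le_pow_right (by omega) (by omega)
    refine (add_le_add h1 h2).trans ?_
    rw [hE, pow_succ, ← mul_two]
    exact Nat.mul_le_mul_left _ hX2
  have hone : (1 : ℝ) ≤ 2 ^ h n := Real.one_le_rpow (by norm_num) (hh0 n)
  have hbase := hexp n _ (pathwidth_wire_le (wellFormed_formula hlt))
  dsimp only
  calc (((codeSize (n, clauseLists φ) + 2) ^ j : ℕ) : ℝ) + _
      ≤ 2 ^ h n * ((codeSize (n, clauseLists φ) + 2) ^ j : ℕ) + 2 ^ h n *
        (((wireVerts (formulaOps n (clauseLists φ)) (formulaWidth n)).length + 1 : ℕ) : ℝ) ^ k := by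
        gcongr
        exact le_mul_of_one_le_left (by positivity) hone
    _ = 2 ^ h n * (((codeSize (n, clauseLists φ) + 2) ^ j +
        ((wireVerts (formulaOps n (clauseLists φ)) (formulaWidth n)).length + 1) ^ k : ℕ) : ℝ) := by
        push_cast; ring
    _ ≤ 2 ^ h n * ((X ^ E : ℕ) : ℝ) := by gcongr
    _ = _ := by
        rw [Real.rpow_add (by norm_num), Real.rpow_natCast, hX, mul_pow, ← pow_mul, pow_mul 2 4 E]
        push_cast
        ring
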